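/- \textbf{Setting.} Let $\mathbb S$ be a finite state space, $\mathbb A=\{0,1\}$, and consider $N\ge 1$ arms, each of one of $K$ types; $k(i)$ is the type of arm $i$ and $\beta_k N$ is the number of arms of type $k$. An arm of type $k$ in state $s$ under action $a$ yields the reward $r_k(s,a)\in\mathbb R$ and moves to $s'$ with probability $P_k(s,a,s')$; given the states and actions, the arms move independently. Every $P_k$ is unichain: under every stationary Markov policy $\mathbb S\to\mathcal P(\mathbb A)$ the induced chain has exactly one recurrent class. Let $\alpha\in(0,1)$ with $\alpha N\in\mathbb Z$; exactly $\alpha N$ arms must be activated (action $1$) in every time step. For a policy $\pi$ (randomized, history-dependent) obeying this constraint, $V_N^\pi$ is the long-run average as $T\to\infty$ of $\frac1T\sum_{t<T}\frac1N\sum_i\mathbb E[r_{k(i)}(S_i(t),A_i(t))]$ (with $\limsup$ if the limit does not exist), and $V_N^*=\sup_\pi V_N^\pi$. \textbf{LP-Het.} Maximize $\sum_k\sum_{s,a}\beta_k r_k(s,a)y_k(s,a)$ subject to $\sum_k\sum_s\beta_k y_k(s,1)=\alpha$; $\sum_{s',a}y_k(s',a)P_k(s',a,s)=\sum_a y_k(s,a)$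 for all $k,s$; $\sum_{s,a}y_k(s,a)=1$ for all $k$; and $y_k(s,a)\ge 0$. An optimal solution $y^*$ induces the single-armed policies $\bar\pi_k^*(a|s)=y_k^*(s,a)/(y_k^*(s,0)+y_k^*(s,1))$ if the denominator is positive, and $\bar\pi^*_k(a|s)=1/2$ otherwise. \textbf{Synchronization.} For type $k$, the leader-and-follower system starts from given states and actions $(S(0),A(0),\hat S(0),\hat A(0))=(s,a,\hat s,\hat a)$. At each step, if $(S(t),A(t))=(\hat S(t),\hat A(t))$, then $S(t+1)=\hat S(t+1)$ is one sample from $P_k(S(t),A(t),\cdot)$; otherwise $S(t+1)$ and $\hat S(t+1)$ are sampled independently from $P_k(S(t),A(t),\cdot)$ and $P_k(\hat S(t),\hat A(t),\cdot)$. For $t\ge1$, the leader samples $\hat A(t)\sim\bar\pi_k^*(\cdot|\hat S(t))$ and the follower uses $A(t)=\hat A(t)$. The synchronization time is $\tau_k^{\rm sync}(s,a,\hat s,\hat a)=\min\{t\ge 1: S(t)=\hat S(t)\}$. The policy $\bar\pi_k^*$ satisfies the Synchronization Assumption (SA) if $\mathbb E[\tau_k^{\rm sync}(s,a,\hat s,\hat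 a)]<\infty$ for all $(s,a,\hat s,\hat a)$. \textbf{FTVA$(\{\bar\pi^*_k\})$.} From arbitrary real states $S_i(0)$, the virtual states $\hat S_i(0)$ are sampled independently from the stationary distribution of the chain induced by $\bar\pi^*_{k(i)}$. At each time $t$, virtual actions $\hat A_i(t)\sim\bar\pi^*_{k(i)}(\cdot|\hat S_i(t))$ are sampled independently. If $\sum_i\hat A_i(t)\ge\alpha N$, then $\alpha N$ arms with $\hat A_i(t)=1$ are activated; otherwise all arms with $\hat A_i(t)=1$ are activated, together with $\alpha N-\sum_i\hat A_i(t)$ further arms. Ties are broken arbitrarily. Then, independently over $i$, the pair $(S_i(t+1),\hat S_i(t+1))$ is a single common sample from $P_{k(i)}(S_i(t),A_i(t),\cdot)$ if $(S_i(t),A_i(t))=(\hat S_i(t),\hat A_i(t))$, and otherwise consists of two independent samples from $P_{k(i)}(S_i(t),A_i(t),\cdot)$ and $P_{k(i)}(\hat S_i(t),\hat A_i(t),\cdot)$. \textbf{Theorem.} Let $y^*$ be an optimal solution of LP-Het, and assume that for each $k$ the induced policy $\bar\pi_k^*$ satisfies SA. Then for every $N\ge1$, all initial states and every tie-breaking rule,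 $$V_N^*-V_N^{\mathrm{FTVA}(\{\bar\pi_k^*\})}\le\frac{r_{\max}\,\bar\tau^{\rm sync}_{\max}}{\sqrt N},$$ where $r_{\max}=\max_{k,s,a}|r_k(s,a)|$ and $\bar\tau^{\rm sync}_{\max}=\max_{k,s,a,\hat s,\hat a}\mathbb E[\tau_k^{\rm sync}(s,a,\hat s,\hat a)]$. If tie-breaking depends (possibly at random) only on the current real and virtual states and virtual actions, then the limit that defines $V_N^{\mathrm{FTVA}}$ exists. For history-dependent tie-breaking the bound holds with $\liminf$ in place of the limit. -/

import Mathlib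

open MeasureTheory ProbabilityTheory Filter Topology
open scoped ENNReal

noncomputable section

namespace RestlessBandit

/-- The product law on `ι → X`: the coordinates are sampled independently, coordinate `i`
from `p i`. -/
def productPMF {ι X : Type*} [Fintype ι] [DecidableEq ι] [Fintype X] (p : ι → PMF X) :
    PMF (ι → X) :=
  PMF.ofFintype (fun x => ∏ i, p i (x i)) (by
    rw [← Fintype.piFinset_univ, ← Finset.prod_univ_sum (fun _ => Finset.univ)
      (fun i x => p i x)]
    refine Finset.prod_eq_one fun i _ => ?_
    exact (tsum_fintype (fun x => p i x)).symm.trans (p i).tsum_coe)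

/-! ### A single arm

A single-armed MDP has a transition kernel `P : S → Bool → PMF S`; the action `true` means that
the arm is activated. A stationary Markov policy is a map `S → PMF Bool`. -/

/-- One step of the Markov chain that a policy induces on the states of an arm. -/
def inducedStep {S : Type*} (P : S → Bool → PMF S) (π : S → PMF Bool) (s : S) : PMF S :=
  (π s).bind fun a => P s a

/-- `C` is a recurrent class of a finite-state chain: it is not empty, and the states that can be
reached from any of its members are exactly its members (a closed communicating class). -/
def IsRecurrentClass {S : Type*} (q : S → PMF S) (C : Set S) : Prop :=
  C.Nonempty ∧ ∀ x ∈ C, ∀ y, Relation.ReflTransGen (fun u v => q u v ≠ 0) x y ↔ y ∈ C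

/-- Under every Markov policy, the induced chain has a single recurrent class. -/
def IsUnichain {S : Type*} (P : S → Bool → PMF S) : Prop :=
  ∀ π : S → PMF Bool, ∃! C : Set S, IsRecurrentClass (inducedStep P π) C

/-- `μ` is a stationary distribution of the chain that the policy `π` induces. -/
def IsStationaryDistribution {S : Type*} (P : S → Bool → PMF S) (π : S → PMF Bool)
    (μ : PMF S) : Prop :=
  μ.bind (inducedStep P π) = μ

/-- A pair of state-action pairs. For an arm of the bandit: the real state and action and the
virtual state and action. For a leader-and-follower system: those of the follower and of the
leader. -/
@[ext]
structure ArmPair (S : Type*) where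
  /-- real state, or state of the follower -/
  state : S
  /-- real action, or action of the follower -/
  action : Bool
  /-- virtual state, or state of the leader -/
  vstate : S
  /-- virtual action, or action of the leader -/
  vaction : Bool

/-- Every set of pairs is measurable. -/
instance instMeasurableSpaceArmPair {S : Type*} : MeasurableSpace (ArmPair S) := ⊤

/-- The coupled transition of a pair of states: if the two state-action pairs agree, then the two
next states are the same sample; otherwise they are sampled independently. -/
def coupledStep {S : Type*} [DecidableEq S] (P : S → Bool → PMF S) (x : ArmPair S) :
    PMF (S × S) :=
  if x.state = x.vstate ∧ x.action = x.vaction then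
    (P x.state x.action).map fun s' => (s', s')
  else
    (P x.state x.action).bind fun s' => (P x.vstate x.vaction).map fun v' => (s', v')

/-- One step of the leader-and-follower system: the two states make a coupled transition, then the
leader samples its action from `π`, and the follower takes the same action. -/
def leaderFollowerStep {S : Type*} [DecidableEq S] (P : S → Bool → PMF S) (π : S → PMF Bool)
    (x : ArmPair S) : PMF (ArmPair S) :=
  (coupledStep P x).bind fun z => (π z.2).map fun a => ⟨z.1, a, z.2, a⟩

/-- The one-step kernel of the leader-and-follower system, as a function of the trajectory up to
time `n`. -/
def leaderFollowerKernel {S : Type*} [DecidableEq S] (P : S → Bool → PMF S) (π : S → PMF Bool)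
    (n : ℕ) : Kernel ((i : Finset.Iic n) → ArmPair S) (ArmPair S) :=
  Kernel.comap ⟨fun x => (leaderFollowerStep P π x).toMeasure, measurable_from_top⟩
    (fun h : (i : Finset.Iic n) → ArmPair S => h ⟨n, Finset.mem_Iic.2 le_rfl⟩)
    (measurable_pi_apply _)

instance instIsMarkovKernelLeaderFollowerKernel {S : Type*} [DecidableEq S]
    (P : S → Bool → PMF S) (π : S → PMF Bool) (n : ℕ) :
    IsMarkovKernel (leaderFollowerKernel P π n) :=
  ⟨fun h => PMF.toMeasure.isProbabilityMeasure
    (leaderFollowerStep P π (h ⟨n, Finset.mem_Iic.2 le_rfl⟩))⟩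

/-- The law of the trajectory of the leader-and-follower system that starts from the states and
actions `x`. -/
def leaderFollowerMeasure {S : Type*} [DecidableEq S] (P : S → Bool → PMF S)
    (π : S → PMF Bool) (x : ArmPair S) : Measure (ℕ → ArmPair S) :=
  Kernel.trajMeasure (X := fun _ => ArmPair S) (Measure.dirac x) (leaderFollowerKernel P π)

/-- The synchronization time of a trajectory: the first time `t ≥ 1`, that is, after the given
initial time, at which the two states are identical; it is `∞` if there is none. -/
def syncTime {S : Type*} (ω : ℕ → ArmPair S) : ℝ≥0∞ :=
  ⨅ (t : ℕ) (_ : 1 ≤ t ∧ (ω t).state = (ω t).vstate), (t : ℝ≥0∞)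

/-- The expected synchronization time from the initial states and actions `x`. -/
def expectedSyncTime {S : Type*} [DecidableEq S] (P : S → Bool → PMF S) (π : S → PMF Bool)
    (x : ArmPair S) : ℝ≥0∞ :=
  ∫⁻ ω, syncTime ω ∂(leaderFollowerMeasure P π x)

/-- The Synchronization Assumption for the policy `π`: all expected synchronization times are
finite. -/
def SyncAssumption {S : Type*} [DecidableEq S] (P : S → Bool → PMF S) (π : S → PMF Bool) :
    Prop :=
  ∀ x : ArmPair S, expectedSyncTime P π x < ∞

end RestlessBandit

/-- A restless bandit with `N` arms of `K` types, all with state space `S`. -/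
structure RestlessBandit (N K : ℕ) (S : Type*) where
  /-- transition kernel of each type -/
  trans : Fin K → S → Bool → PMF S
  /-- reward function of each type -/
  reward : Fin K → S → Bool → ℝ
  /-- the type of each arm -/
  armType : Fin N → Fin K
  /-- the number `α N` of arms that are activated in each time step -/
  budget : ℕ

namespace RestlessBandit

variable {N K : ℕ} {S : Type*}

/-- The fraction `α` of arms that are activated in each time step. -/
def alpha (B : RestlessBandit N K S) : ℝ := (B.budget : ℝ) / N

/-- The fraction `β k` of arms that are of type `k`. -/
def beta (B : RestlessBandit N K S) (k : Fin K) : ℝ :=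
  ((Finset.univ.filter fun i => B.armType i = k).card : ℝ) / N

/-- The largest absolute value of a reward, over types, states and actions. -/
def rMax (B : RestlessBandit N K S) : ℝ :=
  ⨆ z : Fin K × S × Bool, |B.reward z.1 z.2.1 z.2.2|

/-- The largest expected synchronization time, over types and initial states and actions. -/
def tauMax [DecidableEq S] (B : RestlessBandit N K S) (π : Fin K → S → PMF Bool) : ℝ :=
  (⨆ (k : Fin K) (x : ArmPair S), expectedSyncTime (B.trans k) (π k) x).toReal

/-! ### The linear program and the policies that it induces -/

/-- The constraints of the linear program. -/
structure LPFeasible [Fintype S] (B : RestlessBandit N K S) (y : Fin K → S → Bool → ℝ) :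
    Prop where
  budget_eq : ∑ k, ∑ s, B.beta k * y k s true = B.alpha
  flow_balance : ∀ k s, ∑ s', ∑ a, y k s' a * (B.trans k s' a s).toReal = ∑ a, y k s a
  sum_eq_one : ∀ k, ∑ s, ∑ a, y k s a = 1
  nonneg : ∀ k s a, 0 ≤ y k s a

/-- The objective of the linear program. -/
def lpObjective [Fintype S] (B : RestlessBandit N K S) (y : Fin K → S → Bool → ℝ) : ℝ :=
  ∑ k, ∑ s, ∑ a, B.beta k * B.reward k s a * y k s a

/-- `y` is an optimal solution of the linear program. -/
def LPOptimal [Fintype S] (B : RestlessBandit N K S) (y : Fin K → S → Bool → ℝ) : Prop :=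
  B.LPFeasible y ∧ ∀ y', B.LPFeasible y' → B.lpObjective y' ≤ B.lpObjective y

/-- The single-armed policies `π` are those induced by the state-action frequencies `y`. -/
def InducedBy (π : Fin K → S → PMF Bool) (y : Fin K → S → Bool → ℝ) : Prop :=
  ∀ k s a, (π k s a).toReal =
    if 0 < y k s false + y k s true then y k s a / (y k s false + y k s true) else 1 / 2

/-! ### Long-run average rewards -/

/-- The expected reward per arm in one time step, if `p` is the joint law of the states and
actions of all arms in that step. -/
def meanReward [Fintype S] (B : RestlessBandit N K S) (p : PMF (Fin N → S × Bool)) : ℝ :=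
  ∑ x, (p x).toReal * ((1 / (N : ℝ)) * ∑ i, B.reward (B.armType i) (x i).1 (x i).2)

/-- The time average, over the first `T` time steps, of the expected reward per arm. -/
def averageReward [Fintype S] (B : RestlessBandit N K S) (p : ℕ → PMF (Fin N → S × Bool))
    (T : ℕ) : ℝ :=
  (1 / (T : ℝ)) * ∑ t ∈ Finset.range T, B.meanReward (p t)

/-- The number of arms that an action vector activates. -/
def numActive (a : Fin N → Bool) : ℕ := (Finset.univ.filter fun i => a i = true).card

/-! ### General policies -/

/-- A (randomized, history-dependent) policy: given the states and actions of all arms at all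
earlier times (most recent first) and the current states, the law of the action vector. -/
abbrev Policy (N : ℕ) (S : Type*) : Type _ :=
  List (Fin N → S × Bool) → (Fin N → S) → PMF (Fin N → Bool)

/-- The budget constraint: the number of activated arms always equals the budget. -/
def Policy.Admissible (B : RestlessBandit N K S) (π : Policy N S) : Prop :=
  ∀ h s, ∀ a ∈ (π h s).support, numActive a = B.budget

/-- The joint law, at time `t`, of the earlier history and the current states and actions, under
the policy `π` with initial states `s₀`. -/
def Policy.law [Fintype S] (B : RestlessBandit N K S) (π : Policy N S) (s₀ : Fin N → S) :
    ℕ → PMF (List (Fin N → S × Bool) × (Fin N → S × Bool))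
  | 0 => (π [] s₀).map fun a => ([], fun i => (s₀ i, a i))
  | t + 1 => (Policy.law B π s₀ t).bind fun hx =>
      (productPMF fun i => B.trans (B.armType i) (hx.2 i).1 (hx.2 i).2).bind fun s =>
        (π (hx.2 :: hx.1) s).map fun a => (hx.2 :: hx.1, fun i => (s i, a i))

/-- The optimal long-run average reward per arm from the initial states `s₀`: the supremum over
all policies that satisfy the budget constraint. The value of a policy for which the limit of the
time averages does not exist is taken to be their limit superior. -/
def optimalValue [Fintype S] (B : RestlessBandit N K S) (s₀ : Fin N → S) : ℝ :=
  ⨆ π : {π : Policy N S // Policy.Admissible B π},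
    limsup (B.averageReward fun t => (Policy.law B π.1 s₀ t).map Prod.snd) atTop

/-! ### Follow-the-Virtual-Advice -/

/-- The action vectors `a` that may be applied when the virtual actions are `va`: exactly the
budgeted number of arms is activated, and they are chosen among those with virtual action `1` if
there are enough of these, and otherwise include all of these. -/
def IsSelection (B : RestlessBandit N K S) (va a : Fin N → Bool) : Prop :=
  numActive a = B.budget ∧
    if B.budget ≤ numActive va then ∀ i, a i = true → va i = true
    else ∀ i, va i = true → a i = true

/-- A (possibly randomized and history-dependent) way to break ties: given the real and virtual
states and actions of all arms at all earlier times (most recent first), the current real states,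
virtual states and virtual actions, the law of the vector of real actions. -/
abbrev TieBreaking (N : ℕ) (S : Type*) : Type _ :=
  List (Fin N → ArmPair S) → (Fin N → S) → (Fin N → S) → (Fin N → Bool) → PMF (Fin N → Bool)

/-- The tie-breaking only makes selections that the algorithm allows. -/
def TieBreaking.Valid (B : RestlessBandit N K S) (tb : TieBreaking N S) : Prop :=
  ∀ h s v va, ∀ a ∈ (tb h s v va).support, B.IsSelection va a

/-- The tie-breaking does not depend on the past, so that the real and virtual states form a
time-homogeneous Markov chain. -/
def TieBreaking.Stationary (tb : TieBreaking N S) : Prop :=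
  ∀ h h', tb h = tb h'

/-- The action phase of a time step: virtual actions are sampled independently from the
single-armed policies of the types, then the real actions are selected. -/
def ftvaAct (B : RestlessBandit N K S) (π : Fin K → S → PMF Bool) (tb : TieBreaking N S)
    (h : List (Fin N → ArmPair S)) (s v : Fin N → S) :
    PMF (List (Fin N → ArmPair S) × (Fin N → ArmPair S)) :=
  (productPMF fun i => π (B.armType i) (v i)).bind fun va =>
    (tb h s v va).map fun a => (h, fun i => ⟨s i, a i, v i, va i⟩)

/-- The joint law, at time `t`, of the earlier history and the current real and virtual states and
actions, under Follow-the-Virtual-Advice with the single-armed policies `π`, the initial real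
states `s₀`, and independent initial virtual states with laws `μ` (depending on the type). -/
def ftvaLaw [Fintype S] [DecidableEq S] (B : RestlessBandit N K S) (π : Fin K → S → PMF Bool)
    (μ : Fin K → PMF S) (tb : TieBreaking N S) (s₀ : Fin N → S) :
    ℕ → PMF (List (Fin N → ArmPair S) × (Fin N → ArmPair S))
  | 0 => (productPMF fun i => μ (B.armType i)).bind fun v => B.ftvaAct π tb [] s₀ v
  | t + 1 => (ftvaLaw B π μ tb s₀ t).bind fun hx =>
      (productPMF fun i => coupledStep (B.trans (B.armType i)) (hx.2 i)).bind fun z =>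
        B.ftvaAct π tb (hx.2 :: hx.1) (fun i => (z i).1) (fun i => (z i).2)

/-- The time averages of the expected reward per arm under Follow-the-Virtual-Advice. -/
def ftvaAverageReward [Fintype S] [DecidableEq S] (B : RestlessBandit N K S)
    (π : Fin K → S → PMF Bool) (μ : Fin K → PMF S) (tb : TieBreaking N S) (s₀ : Fin N → S) :
    ℕ → ℝ :=
  B.averageReward fun t =>
    (B.ftvaLaw π μ tb s₀ t).map fun hx i => ((hx.2 i).state, (hx.2 i).action)

end RestlessBandit

end

/-! The value of the linear program separates the two sides. From above, it bounds every admissible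
policy: limit points of the expected state-action frequencies of the arms, averaged over the arms of
each type, are feasible (`limsup_averageReward_le`, `arm_objective_le`). This bound does not see the
initial states, so the two sides may start differently.

From below, the virtual arms stay independent and stationary whatever the real arms do
(`ftvaLaw_map_virtual`). By unichainness their state-action frequencies are exactly `y`
(`stationary_mul_policy`), so they earn the LP value in every step. The real system loses at most `2
* rMax / N` per arm whose real and virtual state-action pairs differ, and it remains to count these
arms.

The count is a drift argument. Let `h` be the expected number of steps up to synchronization,
written as a sum of survival probabilities; it satisfies `h = killedStep h + 1` and is at most `τ =
tauMax`. Weigh each mismatched arm by `h`. An arm that follows its virtual action makes a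
leader-and-follower step, which lowers its expected weight by one if it is mismatched; an arm that
has to disobey adds at most `τ` (`totalPotential_succ_add_le`). The number of disobeying arms is the
deviation of the number of virtual activations from the budget, which is its mean; independence
bounds the expected deviation by `√N / 2`. Telescoping gives at most `N * τ + T * τ * √N / 2`
expected mismatches up to time `T`, and multiplication by `2 * rMax / (N * T)` leaves `rMax * τ /
√N` and a term of order `1 / T`.

With stationary tie-breaking the arms form a finite Markov chain, whose time averages converge by a
mean ergodic theorem. -/

namespace RestlessBandit

/-! ### Expectations under discrete laws, extended nonnegative and real -/

section Expectation

variable {α β : Type*}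

/-- The expectation of a nonnegative function. -/
noncomputable def expect (p : PMF α) (f : α → ℝ≥0∞) : ℝ≥0∞ := ∑' a, p a * f a

theorem expect_bind (p : PMF α) (q : α → PMF β) (f : β → ℝ≥0∞) :
    expect (p.bind q) f = expect p fun a => expect (q a) f := by
  simp only [expect, PMF.bind_apply, ← ENNReal.tsum_mul_right, ← ENNReal.tsum_mul_left]
  rw [ENNReal.tsum_comm]
  simp only [mul_assoc]

theorem expect_pure (a : α) (f : α → ℝ≥0∞) : expect (PMF.pure a) f = f a := by
  rw [expect, tsum_eq_single a]
  · simp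
  · intro b hb
    simp [PMF.pure_apply, hb]

theorem expect_map (p : PMF α) (g : α → β) (f : β → ℝ≥0∞) :
    expect (p.map g) f = expect p fun a => f (g a) := by
  rw [PMF.map, expect_bind]
  simp [expect_pure]

theorem expect_mono {p : PMF α} {f g : α → ℝ≥0∞} (h : ∀ a ∈ p.support, f a ≤ g a) :
    expect p f ≤ expect p g := by
  refine ENNReal.tsum_le_tsum fun a => ?_
  by_cases ha : p a = 0
  · simp [ha]
  · gcongr
    exact h a ((PMF.mem_support_iff _ _).2 ha)

theorem expect_congr {p : PMF α} {f g : α → ℝ≥0∞} (h : ∀ a ∈ p.support, f a = g a) :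
    expect p f = expect p g :=
  le_antisymm (expect_mono fun a ha => (h a ha).le) (expect_mono fun a ha => (h a ha).ge)

theorem expect_add (p : PMF α) (f g : α → ℝ≥0∞) :
    expect p (fun a => f a + g a) = expect p f + expect p g := by
  simp only [expect, mul_add, ENNReal.tsum_add]

theorem expect_const_mul (p : PMF α) (c : ℝ≥0∞) (f : α → ℝ≥0∞) :
    expect p (fun a => c * f a) = c * expect p f := by
  simp only [expect, ← ENNReal.tsum_mul_left, mul_left_comm]

theorem expect_const (p : PMF α) (c : ℝ≥0∞) : expect p (fun _ => c) = c := by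
  simp only [expect, ENNReal.tsum_mul_right, p.tsum_coe, one_mul]

theorem expect_sum {ι : Type*} (p : PMF α) (s : Finset ι) (f : ι → α → ℝ≥0∞) :
    expect p (fun a => ∑ i ∈ s, f i a) = ∑ i ∈ s, expect p (f i) := by
  simp only [expect, Finset.mul_sum]
  exact Summable.tsum_finsetSum fun _ _ => ENNReal.summable

theorem expect_tsum {ι : Type*} (p : PMF α) (f : ι → α → ℝ≥0∞) :
    expect p (fun a => ∑' i, f i a) = ∑' i, expect p (f i) := by
  simp only [expect, ← ENNReal.tsum_mul_left]
  exact ENNReal.tsum_comm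

variable [Fintype α]

theorem toReal_bind_apply (p : PMF α) (q : α → PMF β) (b : β) :
    (p.bind q b).toReal = ∑ a, (p a).toReal * (q a b).toReal := by
  rw [PMF.bind_apply, tsum_fintype, ENNReal.toReal_sum]
  · simp [ENNReal.toReal_mul]
  · exact fun a _ => ENNReal.mul_ne_top (p.apply_ne_top a) ((q a).apply_ne_top b)

variable [Fintype β]

/-- The expectation of a real function on a finite type. -/
noncomputable def mean (p : PMF α) (f : α → ℝ) : ℝ := ∑ a, (p a).toReal * f a

theorem expect_ofReal (p : PMF α) {f : α → ℝ} (hf : ∀ a, 0 ≤ f a) :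
    expect p (fun a => ENNReal.ofReal (f a)) = ENNReal.ofReal (mean p f) := by
  rw [expect, mean, tsum_fintype, ENNReal.ofReal_sum_of_nonneg]
  · refine Finset.sum_congr rfl fun a _ => ?_
    rw [ENNReal.ofReal_mul ENNReal.toReal_nonneg, ENNReal.ofReal_toReal (p.apply_ne_top a)]
  · exact fun a _ => mul_nonneg ENNReal.toReal_nonneg (hf a)

theorem mean_pure (a : α) (f : α → ℝ) : mean (PMF.pure a) f = f a := by
  classical
  rw [mean, Finset.sum_eq_single a] <;> simp +contextual [PMF.pure_apply]

theorem mean_bind (p : PMF α) (q : α → PMF β) (f : β → ℝ) :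
    mean (p.bind q) f = mean p fun a => mean (q a) f := by
  simp only [mean, toReal_bind_apply, Finset.sum_mul, Finset.mul_sum]
  rw [Finset.sum_comm]
  simp only [mul_assoc]

theorem mean_map (p : PMF α) (g : α → β) (f : β → ℝ) :
    mean (p.map g) f = mean p fun a => f (g a) := by
  rw [PMF.map, mean_bind]
  simp [mean_pure]

theorem sum_toReal_eq_one (p : PMF α) : ∑ a, (p a).toReal = 1 := by
  rw [← ENNReal.toReal_sum fun a _ => p.apply_ne_top a, ← tsum_fintype (L := .unconditional α) (fun a => p a), p.tsum_coe]
  rfl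

theorem mean_const (p : PMF α) (c : ℝ) : mean p (fun _ => c) = c := by
  rw [mean, ← Finset.sum_mul, sum_toReal_eq_one, one_mul]

theorem mean_mono {p : PMF α} {f g : α → ℝ} (h : ∀ a ∈ p.support, f a ≤ g a) :
    mean p f ≤ mean p g := by
  refine Finset.sum_le_sum fun a _ => ?_
  by_cases ha : p a = 0
  · simp [ha]
  · exact mul_le_mul_of_nonneg_left (h a ((PMF.mem_support_iff _ _).2 ha)) ENNReal.toReal_nonneg

theorem mean_congr {p : PMF α} {f g : α → ℝ} (h : ∀ a ∈ p.support, f a = g a) :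
    mean p f = mean p g :=
  le_antisymm (mean_mono fun a ha => (h a ha).le) (mean_mono fun a ha => (h a ha).ge)

theorem mean_add (p : PMF α) (f g : α → ℝ) :
    mean p (fun a => f a + g a) = mean p f + mean p g := by
  simp only [mean, mul_add, Finset.sum_add_distrib]

theorem mean_sub (p : PMF α) (f g : α → ℝ) :
    mean p (fun a => f a - g a) = mean p f - mean p g := by
  simp only [mean, mul_sub, Finset.sum_sub_distrib]

theorem mean_const_mul (p : PMF α) (c : ℝ) (f : α → ℝ) :
    mean p (fun a => c * f a) = c * mean p f := by
  simp only [mean, Finset.mul_sum, mul_left_comm]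

theorem mean_sum {ι : Type*} (p : PMF α) (s : Finset ι) (f : ι → α → ℝ) :
    mean p (fun a => ∑ i ∈ s, f i a) = ∑ i ∈ s, mean p (f i) := by
  simp only [mean, Finset.mul_sum]
  exact Finset.sum_comm

theorem mean_nonneg {p : PMF α} {f : α → ℝ} (h : ∀ a, 0 ≤ f a) : 0 ≤ mean p f :=
  Finset.sum_nonneg fun a _ => mul_nonneg ENNReal.toReal_nonneg (h a)

theorem mean_indicator_eq [DecidableEq α] (p : PMF α) (b : α) :
    mean p (fun a => if a = b then 1 else 0) = (p b).toReal := by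
  simp [mean]

/-- Jensen's inequality for the square. -/
theorem sq_mean_le (p : PMF α) (f : α → ℝ) : mean p f ^ 2 ≤ mean p fun a => f a ^ 2 := by
  have h : 0 ≤ mean p fun a => (f a - mean p f) ^ 2 := mean_nonneg fun a => sq_nonneg _
  have e : (fun a => (f a - mean p f) ^ 2)
      = fun a => (f a ^ 2 - 2 * mean p f * f a) + mean p f ^ 2 := by
    funext a; ring
  rw [e, mean_add, mean_sub, mean_const_mul, mean_const] at h
  nlinarith

end Expectation

/-! ### Product laws and the deviation of a number of successes -/

section Product

variable {ι X Y : Type*} [Fintype ι] [DecidableEq ι] [Fintype X] [Fintype Y]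

theorem productPMF_apply (p : ι → PMF X) (x : ι → X) :
    productPMF p x = ∏ i, p i (x i) := rfl

theorem productPMF_pure (x : ι → X) :
    productPMF (fun i => PMF.pure (x i)) = PMF.pure x := by
  classical
  ext y
  rw [productPMF_apply]
  by_cases h : y = x
  · simp [h]
  · rw [PMF.pure_apply_of_ne _ _ h]
    obtain ⟨i, hi⟩ := Function.ne_iff.1 h
    exact Finset.prod_eq_zero (Finset.mem_univ i) (PMF.pure_apply_of_ne _ _ hi)

theorem productPMF_bind (p : ι → PMF X) (q : ι → X → PMF Y) :
    ((productPMF p).bind fun x => productPMF fun i => q i (x i))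
      = productPMF fun i => (p i).bind (q i) := by
  classical
  ext y
  simp only [PMF.bind_apply, productPMF_apply, tsum_fintype, ← Finset.prod_mul_distrib]
  rw [Finset.prod_univ_sum, Fintype.piFinset_univ]

theorem productPMF_map (p : ι → PMF X) (g : ι → X → Y) :
    (productPMF p).map (fun x i => g i (x i)) = productPMF fun i => (p i).map (g i) := by
  simp only [PMF.map, ← productPMF_bind]
  congr 1
  funext x
  exact (productPMF_pure _).symm

theorem mean_productPMF_prod (p : ι → PMF X) (g : ι → X → ℝ) :
    mean (productPMF p) (fun x => ∏ i, g i (x i)) = ∏ i, mean (p i) (g i) := by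
  classical
  simp only [mean, productPMF_apply, ENNReal.toReal_prod, ← Finset.prod_mul_distrib]
  rw [Finset.prod_univ_sum, Fintype.piFinset_univ]

/-- The indicator of `x i = b` is a product over the coordinates with factor `1` away from `i`, so
its expectation factorizes. -/
theorem productPMF_map_eval (p : ι → PMF X) (i : ι) :
    (productPMF p).map (fun x => x i) = p i := by
  classical
  ext b
  rw [← ENNReal.toReal_eq_toReal_iff' (PMF.apply_ne_top _ _) (PMF.apply_ne_top _ _),
    ← mean_indicator_eq, mean_map]
  have h := mean_productPMF_prod p fun j c => if j = i then (if c = b then 1 else 0) else 1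
  simp only [Finset.prod_ite_eq', Finset.mem_univ, if_true] at h
  rw [h, Finset.prod_eq_single i]
  · simp [mean_indicator_eq]
  · intro j _ hj
    simp [hj, mean_const]
  · simp

theorem mean_productPMF_eval (p : ι → PMF X) (i : ι) (f : X → ℝ) :
    mean (productPMF p) (fun x => f (x i)) = mean (p i) f := by
  rw [← productPMF_map_eval p i, mean_map]

theorem mean_productPMF_mul_of_ne (p : ι → PMF X) {i j : ι} (hij : i ≠ j) (f g : X → ℝ) :
    mean (productPMF p) (fun x => f (x i) * g (x j)) = mean (p i) f * mean (p j) g := by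
  have h := mean_productPMF_prod p fun l c => (if l = i then f c else 1) * if l = j then g c else 1
  simp only [Finset.prod_mul_distrib, Finset.prod_ite_eq', Finset.mem_univ, if_true] at h
  rw [h, ← Finset.prod_erase_mul _ _ (Finset.mem_univ i),
    ← Finset.prod_erase_mul _ _ (Finset.mem_erase.2 ⟨hij.symm, Finset.mem_univ j⟩),
    Finset.prod_eq_one]
  · simp [hij, hij.symm, mul_comm]
  · intro l hl
    simp only [Finset.mem_erase, Finset.mem_univ, and_true] at hl
    simp [hl.1, hl.2, mean_const]

/-- The second moment of a sum of independent centred variables. -/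
theorem mean_productPMF_sq_sum (p : ι → PMF X) (f : ι → X → ℝ) (hf : ∀ i, mean (p i) (f i) = 0) :
    mean (productPMF p) (fun x => (∑ i, f i (x i)) ^ 2) = ∑ i, mean (p i) fun c => f i c ^ 2 := by
  simp only [sq, Finset.sum_mul_sum, mean_sum]
  refine Finset.sum_congr rfl fun i _ => ?_
  rw [Finset.sum_eq_single i]
  · exact mean_productPMF_eval p i fun c => f i c * f i c
  · intro j _ hj
    rw [mean_productPMF_mul_of_ne p hj.symm, hf, zero_mul]
  · simp

/-- The number of successes in independent trials deviates from its mean by at most half the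
square root of the number of trials, in expectation. -/
theorem mean_abs_card_sub_le (p : ι → PMF X) (b : X → Bool) :
    mean (productPMF p) (fun x => |((Finset.univ.filter fun i => b (x i) = true).card : ℝ)
      - ∑ i, mean (p i) fun c => if b c then 1 else 0|) ≤ √(Fintype.card ι) / 2 := by
  set m : ι → ℝ := fun i => mean (p i) fun c => if b c then 1 else 0 with hm
  have key : ∀ x : ι → X, ((Finset.univ.filter fun i => b (x i) = true).card : ℝ) - ∑ i, m i
      = ∑ i, ((if b (x i) then 1 else 0) - m i) := by
    intro x
    rw [Finset.sum_sub_distrib, Finset.sum_boole]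
  have hsq : mean (productPMF p) (fun x => |((Finset.univ.filter fun i => b (x i) = true).card : ℝ)
      - ∑ i, m i|) ^ 2 ≤ (√(Fintype.card ι) / 2) ^ 2 := by
    refine (sq_mean_le _ _).trans ?_
    simp only [sq_abs, key]
    rw [mean_productPMF_sq_sum p (fun i c => (if b c then 1 else 0) - m i)
      (fun i => by rw [mean_sub, mean_const]; simp [hm])]
    -- The variance of a Bernoulli variable is `m - m ^ 2`, at most `1 / 4`. This is the source of
    -- the factor `1 / 2` in front of `√N`.
    have hi : ∀ i, mean (p i) (fun c => ((if b c then 1 else 0) - m i) ^ 2) ≤ 1 / 4 := by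
      intro i
      have e : (fun c => ((if b c then (1 : ℝ) else 0) - m i) ^ 2)
          = fun c => (1 - 2 * m i) * (if b c then 1 else 0) + m i ^ 2 := by
        funext c
        split_ifs <;> ring
      rw [e, mean_add, mean_const_mul, mean_const]
      change (1 - 2 * m i) * m i + m i ^ 2 ≤ 1 / 4
      nlinarith [sq_nonneg (m i - 1 / 2)]
    calc _ ≤ ∑ _i : ι, (1 / 4 : ℝ) := Finset.sum_le_sum fun i _ => hi i
      _ = _ := by
        rw [div_pow, Real.sq_sqrt (by positivity)]
        simp
        ring
  exact le_of_sq_le_sq hsq (by positivity)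

end Product

end RestlessBandit

namespace RestlessBandit

/-! ### Survival probabilities of the leader-and-follower system -/

section Synchronization

variable {S : Type*}

/-- A pair of state-action pairs as a tuple. -/
def armPairEquiv (S : Type*) : ArmPair S ≃ S × Bool × S × Bool where
  toFun x := (x.state, x.action, x.vstate, x.vaction)
  invFun z := ⟨z.1, z.2.1, z.2.2.1, z.2.2.2⟩
  left_inv _ := rfl
  right_inv _ := rfl

instance instFintypeArmPair [Fintype S] : Fintype (ArmPair S) :=
  Fintype.ofEquiv _ (armPairEquiv S).symm

instance instDiscreteMeasurableSpaceArmPair : DiscreteMeasurableSpace (ArmPair S) :=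
  ⟨fun _ => trivial⟩

theorem lintegral_toMeasure [Fintype S] (p : PMF (ArmPair S)) (f : ArmPair S → ℝ≥0∞) :
    ∫⁻ x, f x ∂p.toMeasure = expect p f := by
  rw [lintegral_fintype, expect, tsum_fintype]
  refine Finset.sum_congr rfl fun x _ => ?_
  rw [PMF.toMeasure_apply_singleton _ _ (measurableSet_singleton x), mul_comm]

variable [DecidableEq S]

/-- The indicator that the two states differ. -/
def unsynced (x : ArmPair S) : ℝ≥0∞ := if x.state = x.vstate then 0 else 1

/-- The transition operator of the leader-and-follower system, killed upon synchronization. -/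
noncomputable def killedStep (P : S → Bool → PMF S) (π : S → PMF Bool) (f : ArmPair S → ℝ≥0∞)
    (x : ArmPair S) : ℝ≥0∞ :=
  expect (leaderFollowerStep P π x) fun x' => unsynced x' * f x'

/-- The `n`-th product indicates that no synchronization happens at times `1, …, n`. It vanishes
once `n` reaches a synchronization time, so at most that many terms survive. -/
theorem tsum_unsynced_le_syncTime (ω : ℕ → ArmPair S) :
    ∑' n, ∏ j ∈ Finset.range n, unsynced (ω (j + 1)) ≤ syncTime ω := by
  refine le_iInf₂ fun t ht => ?_
  rw [tsum_eq_sum (s := Finset.range t)]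
  · calc _ ≤ ∑ _n ∈ Finset.range t, (1 : ℝ≥0∞) := by
          refine Finset.sum_le_sum fun n _ => Finset.prod_le_one' fun j _ => ?_
          unfold unsynced
          split_ifs <;> simp
      _ = t := by simp
  · intro n hn
    rw [Finset.mem_range, not_lt] at hn
    -- Factor `j` looks at time `j + 1`, so time `t` belongs to `j = t - 1`; the subtraction is
    -- genuine because `1 ≤ t`.
    refine Finset.prod_eq_zero (i := t - 1) (Finset.mem_range.2 (by omega)) ?_
    rw [Nat.sub_add_cancel ht.1, unsynced, if_pos ht.2]

/-- The expected number of steps before synchronization, as a sum of survival probabilities. -/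
noncomputable def syncPotential (P : S → Bool → PMF S) (π : S → PMF Bool) (x : ArmPair S) :
    ℝ≥0∞ :=
  ∑' n, (killedStep P π)^[n] 1 x

/-- First-step analysis: the term `n = 0` contributes `1`, and the other terms contain one more
application of the killed operator. -/
theorem syncPotential_eq (P : S → Bool → PMF S) (π : S → PMF Bool) (x : ArmPair S) :
    syncPotential P π x = killedStep P π (syncPotential P π) x + 1 := by
  rw [syncPotential, _root_.tsum_eq_zero_add' ENNReal.summable, add_comm, killedStep]
  simp only [Function.iterate_succ_apply', syncPotential, ← ENNReal.tsum_mul_left, expect_tsum]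
  rfl

variable [Fintype S]

/-- The Markov property at time `m`: the law of the past and the next pair is the law of the past
composed with the one-step kernel, which reads only the last coordinate. -/
theorem lintegral_leaderFollowerMeasure_succ (P : S → Bool → PMF S) (π : S → PMF Bool)
    (x : ArmPair S) (m : ℕ) {F : ((i : Finset.Iic m) → ArmPair S) → ℝ≥0∞} (hF : Measurable F)
    (g : ArmPair S → ℝ≥0∞) :
    ∫⁻ ω, F (Preorder.frestrictLe m ω) * g (ω (m + 1)) ∂leaderFollowerMeasure P π x
      = ∫⁻ ω, F (Preorder.frestrictLe m ω) * expect (leaderFollowerStep P π (ω m)) g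
          ∂leaderFollowerMeasure P π x := by
  have hg : Measurable g := measurable_from_top
  have h := Kernel.map_frestrictLe_trajMeasure_compProd_eq_map_trajMeasure
    (X := fun _ => ArmPair S) (μ₀ := Measure.dirac x) (κ := leaderFollowerKernel P π) (a := m)
  have h2 := congrArg (fun ρ => ∫⁻ z, F z.1 * g z.2 ∂ρ) h
  have hmeas : Measurable fun z : ((i : Finset.Iic m) → ArmPair S) × ArmPair S =>
    F z.1 * g z.2 := by fun_prop
  rw [Measure.lintegral_compProd hmeas, lintegral_map hmeas (by fun_prop)] at h2
  rw [leaderFollowerMeasure, ← h2, lintegral_map]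
  · refine lintegral_congr fun ω => ?_
    have hk : leaderFollowerKernel P π m (Preorder.frestrictLe m ω)
        = (leaderFollowerStep P π (ω m)).toMeasure := Kernel.comap_apply _ _ _
    rw [hk]
    dsimp only
    rw [lintegral_const_mul _ hg, lintegral_toMeasure]
  · exact hmeas.lintegral_kernel_prod_right'
  · fun_prop

/-- This links the trajectory measure to operator powers. The Markov property removes the last step
and replaces `f` by `killedStep P π f`, so the induction must run over all `f`. -/
theorem lintegral_prod_unsynced (P : S → Bool → PMF S) (π : S → PMF Bool) (x : ArmPair S)
    (m : ℕ) (f : ArmPair S → ℝ≥0∞) :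
    ∫⁻ ω, (∏ j ∈ Finset.range m, unsynced (ω (j + 1))) * f (ω m) ∂leaderFollowerMeasure P π x
      = (killedStep P π)^[m] f x := by
  induction m generalizing f with
  | zero =>
    have hf : Measurable f := measurable_from_top
    have hmeas : Measurable fun w : (i : Finset.Iic 0) → ArmPair S =>
        f (w ⟨0, Finset.mem_Iic.2 le_rfl⟩) := by fun_prop
    have h0 : ∀ z : (i : Finset.Iic 0) → ArmPair S,
        ∫⁻ ω, f (ω 0) ∂(Kernel.traj (X := fun _ => ArmPair S) (leaderFollowerKernel P π) 0 z)
          = f (z ⟨0, Finset.mem_Iic.2 le_rfl⟩) := by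
      intro z
      have h1 := Kernel.traj_map_frestrictLe_apply (X := fun _ => ArmPair S)
        (κ := leaderFollowerKernel P π) 0 0 z
      have h2 := congrArg
        (fun ρ => ∫⁻ w, f (w ⟨0, Finset.mem_Iic.2 le_rfl⟩) ∂ρ) h1
      rw [Kernel.partialTraj_self, Kernel.id_apply, lintegral_dirac' _ hmeas,
        lintegral_map hmeas (by fun_prop)] at h2
      exact h2
    simp only [Finset.range_zero, Finset.prod_empty, one_mul, Function.iterate_zero, id]
    have hf0 : Measurable fun ω : ℕ → ArmPair S => f (ω 0) := by fun_prop
    rw [leaderFollowerMeasure, Kernel.trajMeasure,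
      Measure.lintegral_bind (Kernel.aemeasurable _) hf0.aemeasurable]
    simp only [h0]
    rw [lintegral_map hmeas (by fun_prop), lintegral_dirac' _ (by fun_prop)]
    rfl
  | succ m ih =>
    have hu : Measurable (unsynced (S := S)) := measurable_from_top
    rw [Function.iterate_succ_apply, ← ih]
    have h := lintegral_leaderFollowerMeasure_succ P π x m
      (F := fun z => ∏ j ∈ (Finset.range m).attach, unsynced (z ⟨j + 1, Finset.mem_Iic.2
        (Finset.mem_range.1 j.2)⟩)) (by fun_prop) (fun x' => unsynced x' * f x')
    simp only [Preorder.frestrictLe_apply] at h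
    have e : ∀ ω : ℕ → ArmPair S, ∏ j ∈ (Finset.range m).attach, unsynced (ω (j + 1))
        = ∏ j ∈ Finset.range m, unsynced (ω (j + 1)) := fun ω =>
      Finset.prod_attach (Finset.range m) fun j => unsynced (ω (j + 1))
    simp only [e] at h
    simp only [Finset.prod_range_succ, mul_assoc]
    exact h

theorem syncPotential_le_expectedSyncTime (P : S → Bool → PMF S) (π : S → PMF Bool)
    (x : ArmPair S) : syncPotential P π x ≤ expectedSyncTime P π x := by
  have hu : Measurable (unsynced (S := S)) := measurable_from_top
  calc syncPotential P π x
      = ∑' n, ∫⁻ ω, ∏ j ∈ Finset.range n, unsynced (ω (j + 1)) ∂leaderFollowerMeasure P π x := by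
        refine tsum_congr fun n => ?_
        rw [← lintegral_prod_unsynced]
        simp
    _ = ∫⁻ ω, ∑' n, ∏ j ∈ Finset.range n, unsynced (ω (j + 1)) ∂leaderFollowerMeasure P π x := by
        rw [lintegral_tsum]
        intro n
        exact (Finset.measurable_fun_prod _ fun j _ => by fun_prop).aemeasurable
    _ ≤ _ := lintegral_mono fun ω => tsum_unsynced_le_syncTime ω

end Synchronization

end RestlessBandit

namespace RestlessBandit

/-! ### Uniqueness of the stationary law of a unichain -/

section Stationary

variable {S : Type*}

theorem toReal_inducedStep_apply (P : S → Bool → PMF S) (π : S → PMF Bool) (s s' : S) :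
    (inducedStep P π s s').toReal = ∑ a, (π s a).toReal * (P s a s').toReal :=
  toReal_bind_apply _ _ _

variable [Fintype S]

/-- Among the states reachable from `x`, one whose own reachable set has least cardinality generates
a recurrent class: a member cannot reach a strictly smaller set. -/
theorem exists_isRecurrentClass_reachable (q : S → PMF S) (x : S) :
    ∃ C, IsRecurrentClass q C ∧
      ∀ y ∈ C, Relation.ReflTransGen (fun u v => q u v ≠ 0) x y := by
  let R : S → Set S := fun x => {y | Relation.ReflTransGen (fun u v => q u v ≠ 0) x y}
  obtain ⟨y, hy, hmin⟩ := Set.exists_min_image (R x) (fun z => (R z).ncard) (Set.toFinite _)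
    ⟨x, Relation.ReflTransGen.refl⟩
  refine ⟨R y, ⟨⟨y, Relation.ReflTransGen.refl⟩, fun z hz w => ?_⟩,
    fun z hz => Relation.ReflTransGen.trans hy hz⟩
  have hsub : R z ⊆ R y := fun w hw => Relation.ReflTransGen.trans hz hw
  have heq : R z = R y := Set.eq_of_subset_of_ncard_le hsub
    (hmin z (Relation.ReflTransGen.trans hy hz)) (Set.toFinite _)
  exact Set.ext_iff.1 heq w

/-- The set on which a signed invariant measure is positive is closed. -/
theorem pos_of_step_of_invariant (q : S → PMF S) {m : S → ℝ}
    (hm : ∀ s', m s' = ∑ s, m s * (q s s').toReal) {s s' : S} (hs : 0 < m s) (h : q s s' ≠ 0) :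
    0 < m s' := by
  have hle : ∀ s', max (m s') 0 ≤ ∑ s, max (m s) 0 * (q s s').toReal := by
    intro s'
    refine max_le ?_ (Finset.sum_nonneg fun s _ =>
      mul_nonneg (le_max_right _ _) ENNReal.toReal_nonneg)
    rw [hm s']
    exact Finset.sum_le_sum fun s _ =>
      mul_le_mul_of_nonneg_right (le_max_left _ _) ENNReal.toReal_nonneg
  -- The positive part of `m` is subinvariant, and the kernel preserves total mass. So the
  -- inequality is an equality at every state, and the positive part is itself invariant.
  have hsum : ∑ s', max (m s') 0 = ∑ s', ∑ s, max (m s) 0 * (q s s').toReal := by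
    rw [Finset.sum_comm]
    simp only [← Finset.mul_sum, sum_toReal_eq_one, mul_one]
  have heq := (Finset.sum_eq_sum_iff_of_le fun s' _ => hle s').1 hsum s' (Finset.mem_univ _)
  have hpos : 0 < ∑ s, max (m s) 0 * (q s s').toReal :=
    Finset.sum_pos' (fun s _ => mul_nonneg (le_max_right _ _) ENNReal.toReal_nonneg)
      ⟨s, Finset.mem_univ _, mul_pos (lt_max_of_lt_left hs)
        (ENNReal.toReal_pos h ((q s).apply_ne_top _))⟩
  rw [← heq] at hpos
  simpa using hpos

theorem exists_isRecurrentClass_subset_pos (q : S → PMF S) {m : S → ℝ}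
    (hm : ∀ s', m s' = ∑ s, m s * (q s s').toReal) {s : S} (hs : 0 < m s) :
    ∃ C, IsRecurrentClass q C ∧ ∀ y ∈ C, 0 < m y := by
  obtain ⟨C, hC, h⟩ := exists_isRecurrentClass_reachable q s
  refine ⟨C, hC, fun y hy => ?_⟩
  have hr := h y hy
  clear hy
  induction hr with
  | refl => exact hs
  | tail _ hstep ih => exact pos_of_step_of_invariant q hm ih hstep

/-- A chain with a single recurrent class has at most one stationary distribution. -/
theorem stationary_unique {q : S → PMF S} (hq : ∃! C : Set S, IsRecurrentClass q C)
    {μ ν : PMF S} (hμ : μ.bind q = μ) (hν : ν.bind q = ν) : μ = ν := by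
  set m : S → ℝ := fun s => (μ s).toReal - (ν s).toReal with hm_def
  have hm : ∀ s', m s' = ∑ s, m s * (q s s').toReal := by
    intro s'
    simp only [hm_def, sub_mul, Finset.sum_sub_distrib, ← toReal_bind_apply, hμ, hν]
  have hm' : ∀ s', -m s' = ∑ s, -m s * (q s s').toReal := by
    intro s'
    rw [hm s']
    simp
  have hsum : ∑ s, m s = 0 := by
    simp [hm_def, Finset.sum_sub_distrib, sum_toReal_eq_one]
  have hzero : ∀ s, m s = 0 := by
    -- A nonzero difference of total mass zero takes both signs. Its positive set and its negative
    -- set would each contain a recurrent class, but there is only one.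
    by_contra! hne
    obtain ⟨s, hs⟩ := hne
    obtain ⟨s₁, -, hs₁⟩ := Finset.exists_pos_of_sum_zero_of_exists_nonzero m hsum
      ⟨s, Finset.mem_univ _, hs⟩
    obtain ⟨s₂, -, hs₂⟩ := Finset.exists_pos_of_sum_zero_of_exists_nonzero (fun s => -m s)
      (by simp [hsum]) ⟨s, Finset.mem_univ _, neg_ne_zero.2 hs⟩
    obtain ⟨C₁, hC₁, h₁⟩ := exists_isRecurrentClass_subset_pos q hm hs₁
    obtain ⟨C₂, hC₂, h₂⟩ := exists_isRecurrentClass_subset_pos q hm' hs₂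
    obtain rfl := hq.unique hC₁ hC₂
    obtain ⟨z, hz⟩ := hC₁.1
    linarith [h₁ z hz, h₂ z hz]
  ext s
  exact (ENNReal.toReal_eq_toReal_iff' (μ.apply_ne_top s) (ν.apply_ne_top s)).1
    (sub_eq_zero.1 (hzero s))

/-- In the unichain case, the stationary state-action frequencies of the induced policies are the
given solution of the linear program. -/
theorem stationary_mul_policy {N K : ℕ} (B : RestlessBandit N K S) {y : Fin K → S → Bool → ℝ}
    (hy : B.LPFeasible y) {π : Fin K → S → PMF Bool} (hπ : InducedBy π y) {k : Fin K}
    (hunichain : IsUnichain (B.trans k)) {μ : PMF S}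
    (hμ : IsStationaryDistribution (B.trans k) (π k) μ) (s : S) (a : Bool) :
    (μ s).toReal * (π k s a).toReal = y k s a := by
  have hz : ∀ s, 0 ≤ ∑ a, y k s a := fun s => Finset.sum_nonneg fun a _ => hy.nonneg k s a
  -- Where the state frequency is zero, both entries of `y` vanish by nonnegativity, so the default
  -- `1 / 2` does not matter.
  have hmul : ∀ s a, (∑ a, y k s a) * (π k s a).toReal = y k s a := by
    intro s a
    have hs := hz s
    rw [hπ k s a, Fintype.sum_bool, add_comm] at *
    split_ifs with h
    · field_simp
    · have h0 := hy.nonneg k s false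
      have h1 := hy.nonneg k s true
      have h2 : y k s false + y k s true = 0 := le_antisymm (not_lt.1 h) hs
      rw [h2, zero_mul]
      cases a <;> linarith
  have hsum1 : ∑ s, ENNReal.ofReal (∑ a, y k s a) = 1 := by
    rw [← ENNReal.ofReal_sum_of_nonneg fun s _ => hz s, hy.sum_eq_one k, ENNReal.ofReal_one]
  -- The state marginal of `y` is stationary by flow balance, hence equal to `μ`.
  set ν : PMF S := PMF.ofFintype (fun s => ENNReal.ofReal (∑ a, y k s a)) hsum1 with hν_def
  have hν_apply : ∀ s, (ν s).toReal = ∑ a, y k s a := fun s => ENNReal.toReal_ofReal (hz s)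
  have hν : ν.bind (inducedStep (B.trans k) (π k)) = ν := by
    ext s
    rw [← ENNReal.toReal_eq_toReal_iff' (PMF.apply_ne_top _ _) (PMF.apply_ne_top _ _),
      toReal_bind_apply, hν_apply, ← hy.flow_balance k s]
    simp only [hν_apply, toReal_inducedStep_apply, Finset.mul_sum, ← mul_assoc, hmul]
  rw [stationary_unique (hunichain (π k)) hμ hν, hν_apply, hmul]

end Stationary

end RestlessBandit

namespace RestlessBandit

/-! ### Bounds on rewards and their time averages -/

section Reward

variable {N K : ℕ} {S : Type*} (B : RestlessBandit N K S)

theorem rMax_nonneg : 0 ≤ B.rMax := Real.iSup_nonneg fun _ => abs_nonneg _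

variable [Fintype S]

theorem abs_reward_le_rMax (k : Fin K) (s : S) (a : Bool) : |B.reward k s a| ≤ B.rMax :=
  le_ciSup (f := fun z : Fin K × S × Bool => |B.reward z.1 z.2.1 z.2.2|)
    (Set.finite_range _).bddAbove (k, s, a)

theorem meanReward_eq_mean (p : PMF (Fin N → S × Bool)) :
    B.meanReward p
      = mean p fun x => (1 / (N : ℝ)) * ∑ i, B.reward (B.armType i) (x i).1 (x i).2 := rfl

theorem meanReward_eq_sum (p : PMF (Fin N → S × Bool)) :
    B.meanReward p = (1 / (N : ℝ)) * ∑ i, mean (p.map fun x => x i)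
      fun z => B.reward (B.armType i) z.1 z.2 := by
  rw [meanReward_eq_mean, mean_const_mul, mean_sum]
  simp only [mean_map]

theorem abs_meanReward_le (p : PMF (Fin N → S × Bool)) : |B.meanReward p| ≤ B.rMax := by
  have hb : ∀ x : Fin N → S × Bool,
      |(1 / (N : ℝ)) * ∑ i, B.reward (B.armType i) (x i).1 (x i).2| ≤ B.rMax := by
    intro x
    rw [abs_mul, abs_of_nonneg (by positivity : (0 : ℝ) ≤ 1 / N)]
    have h : |∑ i, B.reward (B.armType i) (x i).1 (x i).2| ≤ N * B.rMax := by
      refine (Finset.abs_sum_le_sum_abs _ _).trans ((Finset.sum_le_sum fun i _ =>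
        B.abs_reward_le_rMax (B.armType i) (x i).1 (x i).2).trans ?_)
      simp
    rcases Nat.eq_zero_or_pos N with hN | hN
    · simp [hN, B.rMax_nonneg]
    · have : (0 : ℝ) < N := Nat.cast_pos.2 hN
      calc _ ≤ 1 / (N : ℝ) * (N * B.rMax) := by gcongr
        _ = B.rMax := by field_simp
  rw [meanReward_eq_mean, abs_le, ← mean_const p B.rMax, ← mean_const p (-_)]
  exact ⟨mean_mono fun x _ => by rw [mean_const]; exact (abs_le.1 (hb x)).1,
    mean_mono fun x _ => (abs_le.1 (hb x)).2⟩

theorem abs_averageReward_le (p : ℕ → PMF (Fin N → S × Bool)) (T : ℕ) :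
    |B.averageReward p T| ≤ B.rMax := by
  rw [averageReward, abs_mul, abs_of_nonneg (by positivity : (0 : ℝ) ≤ 1 / T)]
  rcases Nat.eq_zero_or_pos T with hT | hT
  · simp [hT, B.rMax_nonneg]
  have : (0 : ℝ) < T := Nat.cast_pos.2 hT
  have h : |∑ t ∈ Finset.range T, B.meanReward (p t)| ≤ T * B.rMax := by
    refine (Finset.abs_sum_le_sum_abs _ _).trans ((Finset.sum_le_sum fun t _ =>
      B.abs_meanReward_le (p t)).trans ?_)
    simp
  calc _ ≤ 1 / (T : ℝ) * (T * B.rMax) := by gcongr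
    _ = B.rMax := by field_simp

theorem isBoundedUnder_ge_averageReward (p : ℕ → PMF (Fin N → S × Bool)) :
    IsBoundedUnder (· ≥ ·) atTop (B.averageReward p) :=
  isBoundedUnder_of ⟨-B.rMax, fun T => (abs_le.1 (B.abs_averageReward_le p T)).1⟩

theorem isBoundedUnder_le_averageReward (p : ℕ → PMF (Fin N → S × Bool)) :
    IsBoundedUnder (· ≤ ·) atTop (B.averageReward p) :=
  isBoundedUnder_of ⟨B.rMax, fun T => (abs_le.1 (B.abs_averageReward_le p T)).2⟩

end Reward

/-! ### From frequencies of arms to a feasible point of the linear program -/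

section LinearProgram

variable {N K : ℕ} {S : Type*} {B : RestlessBandit N K S}

/-- Sums over types of sums over the arms of a type. -/
theorem sum_type_sum_arm (f : Fin N → ℝ) :
    ∑ k, ∑ i ∈ Finset.univ.filter (fun i => B.armType i = k), f i = ∑ i, f i :=
  Finset.sum_fiberwise _ _ _

theorem sum_sum_comm {α β γ : Type*} (s : Finset α) (t : Finset β) (u : Finset γ)
    (f : α → β → γ → ℝ) :
    ∑ x ∈ s, ∑ y ∈ t, ∑ z ∈ u, f x y z = ∑ z ∈ u, ∑ x ∈ s, ∑ y ∈ t, f x y z := by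
  rw [Finset.sum_congr rfl fun x _ => Finset.sum_comm, Finset.sum_comm]

variable [Fintype S]

/-- State-action frequencies of the individual arms that satisfy the constraints have an average
reward of at most the value of the linear program. -/
theorem arm_objective_le {y : Fin K → S → Bool → ℝ} (hy : B.LPOptimal y)
    {z : Fin N → S → Bool → ℝ} (hnonneg : ∀ i s a, 0 ≤ z i s a)
    (hsum : ∀ i, ∑ s, ∑ a, z i s a = 1)
    (hflow : ∀ i s, ∑ s', ∑ a, z i s' a * (B.trans (B.armType i) s' a s).toReal = ∑ a, z i s a)
    (hbudget : ∑ i, ∑ s, z i s true = B.budget) :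
    (1 / (N : ℝ)) * ∑ i, ∑ s, ∑ a, B.reward (B.armType i) s a * z i s a ≤ B.lpObjective y := by
  classical
  set A : Fin K → Finset (Fin N) := fun k => Finset.univ.filter fun i => B.armType i = k with hA
  -- A type with no arms has weight `beta k = 0` but must still satisfy its own constraints; it
  -- borrows the values of `y`.
  set y' : Fin K → S → Bool → ℝ := fun k s a =>
    if (A k).card = 0 then y k s a else (1 / ((A k).card : ℝ)) * ∑ i ∈ A k, z i s a with hy'
  have hβ : ∀ k s a, B.beta k * y' k s a = (1 / (N : ℝ)) * ∑ i ∈ A k, z i s a := by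
    intro k s a
    have hb : B.beta k = ((A k).card : ℝ) / N := rfl
    simp only [hy', hb]
    split_ifs with h
    · rw [Finset.card_eq_zero.1 h]
      simp
    · have : ((A k).card : ℝ) ≠ 0 := Nat.cast_ne_zero.2 h
      field_simp
  have hfeas : B.LPFeasible y' := by
    refine ⟨?_, fun k s => ?_, fun k => ?_, fun k s a => ?_⟩
    · simp only [hβ, ← Finset.mul_sum, alpha]
      rw [Finset.sum_congr rfl fun k _ => Finset.sum_comm, sum_type_sum_arm, hbudget]
      ring
    · by_cases h : (A k).card = 0
      · simp only [hy', h, if_true]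
        exact hy.1.flow_balance k s
      · simp only [hy', h, if_false, mul_assoc, ← Finset.mul_sum]
        congr 1
        simp only [Finset.sum_mul]
        rw [sum_sum_comm, Finset.sum_comm (s := Finset.univ (α := Bool))]
        refine Finset.sum_congr rfl fun i hi => ?_
        rw [← hflow i s, (Finset.mem_filter.1 hi).2]
    · by_cases h : (A k).card = 0
      · simp only [hy', h, if_true]
        exact hy.1.sum_eq_one k
      · simp only [hy', h, if_false, ← Finset.mul_sum]
        rw [Finset.sum_congr rfl fun s' _ => Finset.sum_comm, Finset.sum_comm]
        simp only [hsum, Finset.sum_const, nsmul_eq_mul, mul_one]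
        have : ((A k).card : ℝ) ≠ 0 := Nat.cast_ne_zero.2 h
        field_simp
    · simp only [hy']
      split_ifs
      · exact hy.1.nonneg k s a
      · exact mul_nonneg (by positivity) (Finset.sum_nonneg fun i _ => hnonneg i s a)
  refine le_trans (le_of_eq ?_) (hy.2 y' hfeas)
  have e : ∀ k s a, B.beta k * B.reward k s a * y' k s a
      = (1 / (N : ℝ)) * ∑ i ∈ A k, B.reward (B.armType i) s a * z i s a := by
    intro k s a
    rw [mul_right_comm, hβ, mul_assoc, mul_comm (Finset.sum _ _), Finset.mul_sum]
    congr 1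
    refine Finset.sum_congr rfl fun i hi => ?_
    rw [(Finset.mem_filter.1 hi).2]
  simp only [lpObjective, e, ← Finset.mul_sum]
  congr 1
  rw [← sum_type_sum_arm (B := B)]
  refine Finset.sum_congr rfl fun k _ => ?_
  rw [Finset.sum_comm]
  exact Finset.sum_congr rfl fun s _ => Finset.sum_comm

end LinearProgram

/-! ### The linear program bounds long-run averages -/

section UpperBound

variable {N K : ℕ} {S : Type*} {B : RestlessBandit N K S}

/-- The frequency with which an arm is in a given state under a given action up to time `T`. -/
noncomputable def frequency (p : ℕ → PMF (Fin N → S × Bool)) (T : ℕ) (i : Fin N) (s : S)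
    (a : Bool) : ℝ :=
  (1 / (T : ℝ)) * ∑ t ∈ Finset.range T, ((p t).map (fun x => x i) (s, a)).toReal

theorem toReal_map_fst_apply {α β : Type*} [Fintype α] [Fintype β] (q : PMF (α × β)) (x : α) :
    (q.map Prod.fst x).toReal = ∑ b, (q (x, b)).toReal := by
  classical
  rw [← mean_indicator_eq, mean_map, mean, Fintype.sum_prod_type]
  simp

variable (p : ℕ → PMF (Fin N → S × Bool))

theorem frequency_nonneg (T : ℕ) (i : Fin N) (s : S) (a : Bool) : 0 ≤ frequency p T i s a :=
  mul_nonneg (by positivity) (Finset.sum_nonneg fun _ _ => ENNReal.toReal_nonneg)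

variable [Fintype S]

theorem sum_frequency {T : ℕ} (hT : 0 < T) (i : Fin N) :
    ∑ s, ∑ a, frequency p T i s a = 1 := by
  have hT' : (T : ℝ) ≠ 0 := by positivity
  simp only [frequency, ← Finset.mul_sum]
  rw [← Fintype.sum_prod_type' (f := fun s a => ∑ t ∈ Finset.range T,
    ((p t).map (fun x => x i) (s, a)).toReal), Finset.sum_comm]
  simp only [Prod.mk.eta, sum_toReal_eq_one]
  simp [hT']

theorem averageReward_eq_frequency (T : ℕ) :
    B.averageReward p T
      = (1 / (N : ℝ)) * ∑ i, ∑ s, ∑ a, B.reward (B.armType i) s a * frequency p T i s a := by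
  simp only [averageReward, meanReward_eq_sum, frequency, mean, Fintype.sum_prod_type,
    Finset.mul_sum]
  rw [Finset.sum_comm]
  refine Finset.sum_congr rfl fun i _ => ?_
  rw [← sum_sum_comm]
  refine Finset.sum_congr rfl fun s _ => Finset.sum_congr rfl fun a _ =>
    Finset.sum_congr rfl fun t _ => ?_
  ring

theorem sum_frequency_budget {T : ℕ} (hT : 0 < T)
    (hp : ∀ t, ∀ x ∈ (p t).support, numActive (fun i => (x i).2) = B.budget) :
    ∑ i, ∑ s, frequency p T i s true = B.budget := by
  have hT' : (T : ℝ) ≠ 0 := by positivity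
  have h : ∀ t, ∑ i, ∑ s, ((p t).map (fun x => x i) (s, true)).toReal = B.budget := by
    intro t
    have e : ∀ i, ∑ s, ((p t).map (fun x => x i) (s, true)).toReal
        = mean (p t) fun x => if (x i).2 = true then 1 else 0 := by
      intro i
      rw [← mean_map (p t) (fun x => x i) fun z => if z.2 = true then 1 else 0, mean,
        Fintype.sum_prod_type]
      simp
    simp only [e, ← mean_sum, Finset.sum_boole]
    rw [← mean_const (p t) (B.budget : ℝ)]
    exact mean_congr fun x hx => congrArg Nat.cast (hp t x hx)
  simp only [frequency, ← Finset.mul_sum]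
  rw [sum_sum_comm]
  simp only [h]
  simp [hT']

/-- Flow out of time `t` is the state law at time `t + 1`. The difference of the two sums telescopes
to the first and last probabilities, both in `[0, 1]`. -/
theorem frequency_flow (hp : ∀ t i, (p (t + 1)).map (fun x => (x i).1)
      = (p t).bind fun x => B.trans (B.armType i) (x i).1 (x i).2)
    (T : ℕ) (i : Fin N) (s : S) :
    |∑ s', ∑ a, frequency p T i s' a * (B.trans (B.armType i) s' a s).toReal
      - ∑ a, frequency p T i s a| ≤ 1 / (T : ℝ) := by
  set g : ℕ → ℝ := fun t => ((p t).map (fun x => (x i).1) s).toReal with hg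
  have hg_eq : ∀ t, ∑ a, ((p t).map (fun x => x i) (s, a)).toReal = g t := by
    intro t
    rw [← toReal_map_fst_apply, PMF.map_comp]
    rfl
  have hg_succ : ∀ t, ∑ s', ∑ a, ((p t).map (fun x => x i) (s', a)).toReal
      * (B.trans (B.armType i) s' a s).toReal = g (t + 1) := by
    intro t
    have e : (p (t + 1)).map (fun x => (x i).1)
        = ((p t).map fun x => x i).bind fun z => B.trans (B.armType i) z.1 z.2 := by
      rw [hp, PMF.bind_map]
      rfl
    simp only [hg]
    rw [e, toReal_bind_apply, Fintype.sum_prod_type]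
  have h1 : ∑ s', ∑ a, frequency p T i s' a * (B.trans (B.armType i) s' a s).toReal
      = (1 / (T : ℝ)) * ∑ t ∈ Finset.range T, g (t + 1) := by
    simp only [frequency, mul_assoc, ← Finset.mul_sum, Finset.sum_mul, ← hg_succ]
    rw [sum_sum_comm]
  have h2 : ∑ a, frequency p T i s a = (1 / (T : ℝ)) * ∑ t ∈ Finset.range T, g t := by
    simp only [frequency, ← Finset.mul_sum, ← hg_eq]
    rw [Finset.sum_comm]
  have hg0 : ∀ t, 0 ≤ g t := fun t => ENNReal.toReal_nonneg
  have hg1 : ∀ t, g t ≤ 1 := fun t =>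
    ENNReal.toReal_le_of_le_ofReal zero_le_one (by
      rw [ENNReal.ofReal_one]
      exact PMF.coe_le_one _ _)
  rw [h1, h2, ← mul_sub, ← Finset.sum_sub_distrib, Finset.sum_range_sub, abs_mul,
    abs_of_nonneg (by positivity : (0 : ℝ) ≤ 1 / T)]
  refine mul_le_of_le_one_right (by positivity) (abs_le.2 ⟨?_, ?_⟩)
  · linarith [hg0 T, hg1 0]
  · linarith [hg1 T, hg0 0]

/-- The linear program bounds the long-run average reward. -/
theorem limsup_averageReward_le {y : Fin K → S → Bool → ℝ} (hy : B.LPOptimal y)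
    (hbudget : ∀ t, ∀ x ∈ (p t).support, numActive (fun i => (x i).2) = B.budget)
    (hstep : ∀ t i, (p (t + 1)).map (fun x => (x i).1)
      = (p t).bind fun x => B.trans (B.armType i) (x i).1 (x i).2) :
    limsup (B.averageReward p) atTop ≤ B.lpObjective y := by
  by_contra! hlt
  obtain ⟨L, hL, hL'⟩ := exists_between hlt
  have hfreq := frequently_lt_of_lt_limsup
    (B.isBoundedUnder_ge_averageReward p).isCoboundedUnder_le hL'
  -- Along these horizons the average stays above `L`. Positivity of the horizon is needed for the
  -- frequencies to sum to one.
  obtain ⟨φ, hφ, hφL⟩ := extraction_of_frequently_atTop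
    (hfreq.and_eventually (eventually_gt_atTop 0))
  have hmem : ∀ n, frequency p (φ n) ∈ Set.Icc (0 : Fin N → S → Bool → ℝ) 1 := by
    intro n
    refine ⟨fun i s a => frequency_nonneg p _ i s a, fun i s a => ?_⟩
    have h := sum_frequency p (hφL n).2 i
    rw [Pi.one_apply, Pi.one_apply, Pi.one_apply, ← h]
    exact (Finset.single_le_sum (f := fun a => frequency p (φ n) i s a)
      (fun a _ => frequency_nonneg p _ i s a) (Finset.mem_univ a)).trans
      (Finset.single_le_sum (f := fun s => ∑ a, frequency p (φ n) i s a)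
      (fun s _ => Finset.sum_nonneg fun a _ => frequency_nonneg p _ i s a) (Finset.mem_univ s))
  obtain ⟨z, hz, ψ, hψ, hlim⟩ := isCompact_Icc.tendsto_subseq hmem
  have hz_apply : ∀ i s a, Tendsto (fun n => frequency p (φ (ψ n)) i s a) atTop (𝓝 (z i s a)) :=
    fun i s a => ((hlim.apply_nhds i).apply_nhds s).apply_nhds a
  have hT : Tendsto (fun n => φ (ψ n)) atTop atTop := (hφ.comp hψ).tendsto_atTop
  -- The constraints pass to the limit; flow balance, violated by at most `1 / T`, becomes exact.
  have hobj := arm_objective_le hy (z := z) hz.1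
    (fun i => tendsto_nhds_unique (tendsto_finsetSum _ fun s _ => tendsto_finsetSum _ fun a _ =>
      hz_apply i s a) (by simp only [sum_frequency p (hφL _).2, tendsto_const_nhds]))
    (fun i s => by
      have h1 : Tendsto (fun n => ∑ s', ∑ a, frequency p (φ (ψ n)) i s' a
          * (B.trans (B.armType i) s' a s).toReal - ∑ a, frequency p (φ (ψ n)) i s a) atTop
          (𝓝 (∑ s', ∑ a, z i s' a * (B.trans (B.armType i) s' a s).toReal - ∑ a, z i s a)) :=
        (tendsto_finsetSum _ fun s' _ => tendsto_finsetSum _ fun a _ =>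
          (hz_apply i s' a).mul_const _).sub (tendsto_finsetSum _ fun a _ => hz_apply i s a)
      have h2 := squeeze_zero_norm (f := fun n => ∑ s', ∑ a, frequency p (φ (ψ n)) i s' a
          * (B.trans (B.armType i) s' a s).toReal - ∑ a, frequency p (φ (ψ n)) i s a)
        (fun n => frequency_flow p hstep (φ (ψ n)) i s)
        ((tendsto_one_div_atTop_nhds_zero_nat (𝕜 := ℝ)).comp hT)
      exact sub_eq_zero.1 (tendsto_nhds_unique h1 h2))
    (tendsto_nhds_unique (tendsto_finsetSum _ fun i _ => tendsto_finsetSum _ fun s _ =>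
      hz_apply i s true) (by
        simp only [sum_frequency_budget p (hφL _).2 hbudget, tendsto_const_nhds]))
  have hlimR : Tendsto (fun n => B.averageReward p (φ (ψ n))) atTop
      (𝓝 ((1 / (N : ℝ)) * ∑ i, ∑ s, ∑ a, B.reward (B.armType i) s a * z i s a)) := by
    simp only [averageReward_eq_frequency]
    exact (tendsto_finsetSum _ fun i _ => tendsto_finsetSum _ fun s _ => tendsto_finsetSum _
      fun a _ => (hz_apply i s a).const_mul _).const_mul _
  have hge := ge_of_tendsto' hlimR fun n => (hφL (ψ n)).1.le
  linarith

end UpperBound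

end RestlessBandit

namespace RestlessBandit

variable {N K : ℕ} {S : Type*} [Fintype S]

/-! ### The relaxation applied to admissible policies -/

section Policies

theorem numActive_of_mem_support_law (B : RestlessBandit N K S) {π : Policy N S}
    (hπ : Policy.Admissible B π) (s₀ : Fin N → S) (t : ℕ)
    {hx : List (Fin N → S × Bool) × (Fin N → S × Bool)}
    (h : hx ∈ (Policy.law B π s₀ t).support) : numActive (fun i => (hx.2 i).2) = B.budget := by
  cases t with
  | zero =>
    rw [Policy.law, PMF.mem_support_map_iff] at h
    obtain ⟨a, ha, rfl⟩ := h
    exact hπ _ _ a ha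
  | succ t =>
    rw [Policy.law, PMF.mem_support_bind_iff] at h
    obtain ⟨_, -, h⟩ := h
    rw [PMF.mem_support_bind_iff] at h
    obtain ⟨_, -, h⟩ := h
    rw [PMF.mem_support_map_iff] at h
    obtain ⟨a, ha, rfl⟩ := h
    exact hπ _ _ a ha

theorem law_succ_map_state (B : RestlessBandit N K S) (π : Policy N S) (s₀ : Fin N → S) (t : ℕ)
    (i : Fin N) :
    ((Policy.law B π s₀ (t + 1)).map Prod.snd).map (fun x => (x i).1)
      = ((Policy.law B π s₀ t).map Prod.snd).bind fun x =>
        B.trans (B.armType i) (x i).1 (x i).2 := by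
  rw [PMF.map_comp, Policy.law, PMF.map_bind, PMF.bind_map]
  congr 1
  funext hx
  simp only [PMF.map_bind, PMF.map_comp, Function.comp_def]
  rw [← productPMF_map_eval (fun i => B.trans (B.armType i) (hx.2 i).1 (hx.2 i).2) i]
  simp only [PMF.map, Function.comp_def, PMF.bind_const]

/-- The linear program is a relaxation of the bandit problem. -/
theorem optimalValue_le_lpObjective {B : RestlessBandit N K S}
    (hne : ∃ π : Policy N S, Policy.Admissible B π) {y : Fin K → S → Bool → ℝ}
    (hy : B.LPOptimal y) (s₀ : Fin N → S) : B.optimalValue s₀ ≤ B.lpObjective y := by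
  have : Nonempty {π : Policy N S // Policy.Admissible B π} := nonempty_subtype.2 hne
  refine ciSup_le fun π => limsup_averageReward_le _ hy (fun t x hx => ?_)
    fun t i => law_succ_map_state B π.1 s₀ t i
  obtain ⟨hx', h, rfl⟩ := (PMF.mem_support_map_iff _ _ _).1 hx
  exact numActive_of_mem_support_law B π.2 s₀ t h

end Policies

/-! ### Virtual arms, the potential and its drift -/

section VirtualAdvice

variable [DecidableEq S]

-- The coupling leaves the virtual marginal untouched in both branches, so virtual arms evolve as if
-- the real ones were absent.
omit [Fintype S] in
theorem coupledStep_map_snd (P : S → Bool → PMF S) (x : ArmPair S) :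
    (coupledStep P x).map Prod.snd = P x.vstate x.vaction := by
  rw [coupledStep]
  split_ifs with h
  · rw [PMF.map_comp, h.1, h.2]
    exact PMF.map_id _
  · simp only [PMF.map_bind, PMF.map_comp, Function.comp_def, PMF.bind_const]
    exact PMF.map_id _

variable (B : RestlessBandit N K S) (π : Fin K → S → PMF Bool) (μ : Fin K → PMF S)
  (tb : TieBreaking N S) (s₀ : Fin N → S)

/-- The joint law of the state and the action of a stationary virtual arm. -/
noncomputable def virtualPMF (k : Fin K) : PMF (S × Bool) :=
  (μ k).bind fun s => (π k s).map fun a => (s, a)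

/-- The virtual states and actions of all arms. -/
def virtualPart (x : Fin N → ArmPair S) : Fin N → S × Bool := fun i => ((x i).vstate, (x i).vaction)

/-- The real states and actions of all arms. -/
def realPart (x : Fin N → ArmPair S) : Fin N → S × Bool := fun i => ((x i).state, (x i).action)

omit [DecidableEq S] in
theorem ftvaAct_map_virtual (h : List (Fin N → ArmPair S)) (s v : Fin N → S) :
    (B.ftvaAct π tb h s v).map (fun hx => virtualPart hx.2)
      = productPMF fun i => (π (B.armType i) (v i)).map fun a => (v i, a) := by
  have e : ∀ a va : Fin N → Bool, (virtualPart fun i => ⟨s i, a i, v i, va i⟩) = fun i => (v i, va i) :=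
    fun _ _ => rfl
  rw [ftvaAct, ← productPMF_map]
  simp only [PMF.map_bind, PMF.map_comp, Function.comp_def, e]
  simp only [PMF.map, Function.comp_def, PMF.bind_const]

/-- The virtual arms are independent and stationary. -/
theorem ftvaLaw_map_virtual (hμ : ∀ k, IsStationaryDistribution (B.trans k) (π k) (μ k)) (t : ℕ) :
    (B.ftvaLaw π μ tb s₀ t).map (fun hx => virtualPart hx.2)
      = productPMF fun i => virtualPMF π μ (B.armType i) := by
  induction t with
  | zero =>
    rw [ftvaLaw, PMF.map_bind]
    simp only [ftvaAct_map_virtual]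
    exact productPMF_bind _ fun i s => (π (B.armType i) s).map fun a => (s, a)
  | succ t ih =>
    have hstep : ∀ x : Fin N → ArmPair S,
        ((productPMF fun i => coupledStep (B.trans (B.armType i)) (x i)).bind fun z =>
          productPMF fun i => (π (B.armType i) (z i).2).map fun a => ((z i).2, a))
        = productPMF fun i => (B.trans (B.armType i) (virtualPart x i).1 (virtualPart x i).2).bind
          fun s => (π (B.armType i) s).map fun a => (s, a) := by
      intro x
      rw [productPMF_bind _ fun i (w : S × S) => (π (B.armType i) w.2).map fun a => (w.2, a)]
      congr 1
      funext i
      change _ = (B.trans (B.armType i) (x i).vstate (x i).vaction).bind _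
      rw [← coupledStep_map_snd (B.trans (B.armType i)) (x i), PMF.bind_map]
      rfl
    rw [ftvaLaw, PMF.map_bind]
    simp only [PMF.map_bind, ftvaAct_map_virtual, hstep]
    have e := PMF.bind_map (B.ftvaLaw π μ tb s₀ t) (fun hx => virtualPart hx.2)
      fun w => productPMF fun i => (B.trans (B.armType i) (w i).1 (w i).2).bind
          fun s => (π (B.armType i) s).map fun a => (s, a)
    simp only [Function.comp_def] at e
    rw [← e, ih, productPMF_bind _ fun i (w : S × Bool) => (B.trans (B.armType i) w.1 w.2).bind
          fun s => (π (B.armType i) s).map fun a => (s, a)]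
    congr 1
    funext i
    have hi := hμ (B.armType i)
    rw [IsStationaryDistribution] at hi
    -- Stationarity is used backwards: one induced step is unfolded on the right only, to match the
    -- step taken on the left.
    conv_rhs => rw [virtualPMF, ← hi]
    simp only [virtualPMF, PMF.bind_bind, PMF.bind_map, inducedStep, Function.comp_def]

/-- The indicator that the two state-action pairs differ. -/
def mismatch (x : ArmPair S) : ℝ≥0∞ := if x.state = x.vstate ∧ x.action = x.vaction then 0 else 1

/-- The indicator that the two actions differ. -/
def disagreement (x : ArmPair S) : ℝ≥0∞ := if x.action = x.vaction then 0 else 1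

/-- The pair in which the virtual action is applied to both states. -/
def followed (x : ArmPair S) : ArmPair S := ⟨x.state, x.vaction, x.vstate, x.vaction⟩

omit [Fintype S] [DecidableEq S] in
theorem ftvaAct_map_followed (h : List (Fin N → ArmPair S)) (s v : Fin N → S) (i : Fin N) :
    (B.ftvaAct π tb h s v).map (fun hx => followed (hx.2 i))
      = (π (B.armType i) (v i)).map fun a => ⟨s i, a, v i, a⟩ := by
  rw [ftvaAct, ← productPMF_map_eval (fun i => π (B.armType i) (v i)) i, PMF.map_comp]
  simp only [PMF.map_bind, PMF.map_comp, Function.comp_def, followed]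
  simp only [PMF.map, Function.comp_def, PMF.bind_const]

/-- Overwriting the real action by the virtual one erases the selection, the only place where arms
interact and ties are broken. Each arm is then left with a plain leader-and-follower step from its
actual pair at time `t`. -/
theorem ftvaLaw_succ_map_followed (t : ℕ) (i : Fin N) :
    (B.ftvaLaw π μ tb s₀ (t + 1)).map (fun hx => followed (hx.2 i))
      = (B.ftvaLaw π μ tb s₀ t).bind fun hx =>
        leaderFollowerStep (B.trans (B.armType i)) (π (B.armType i)) (hx.2 i) := by
  rw [ftvaLaw, PMF.map_bind]
  congr 1
  funext hx
  simp only [PMF.map_bind, ftvaAct_map_followed, leaderFollowerStep]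
  rw [← productPMF_map_eval (fun i => coupledStep (B.trans (B.armType i)) (hx.2 i)) i,
    PMF.bind_map]
  rfl

-- The potential drops by exactly one on a mismatched pair. A matched pair moves to equal states,
-- where the process is killed, so both sides are zero. The additive form avoids subtraction in
-- `ℝ≥0∞`.
omit [Fintype S] in
theorem killedStep_syncPotential (P : S → Bool → PMF S) (ρ : S → PMF Bool) (x : ArmPair S) :
    killedStep P ρ (syncPotential P ρ) x + mismatch x = mismatch x * syncPotential P ρ x := by
  rw [mismatch]
  split_ifs with h
  · rw [killedStep, leaderFollowerStep, coupledStep, if_pos h]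
    simp [expect_bind, expect_map, unsynced, expect_const]
  · rw [syncPotential_eq P ρ x, one_mul]

-- If the actions agree, overwriting changes nothing and a mismatch means different states.
-- Otherwise the crude bound `τ` is charged to the disagreement.
omit [Fintype S] in
theorem mismatch_mul_le {g : ArmPair S → ℝ≥0∞} {τ : ℝ≥0∞} (hg : ∀ x, g x ≤ τ) (x : ArmPair S) :
    mismatch x * g x ≤ unsynced (followed x) * g (followed x) + τ * disagreement x := by
  by_cases h : x.action = x.vaction
  · have hx : followed x = x := by
      ext <;> simp [followed, h]
    rw [hx]
    refine le_trans (le_of_eq ?_) le_self_add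
    simp [mismatch, unsynced, h]
  · simpa [mismatch, disagreement, h] using le_add_left (hg x)

/-- The expected total potential of the arms at time `t`. -/
noncomputable def totalPotential (t : ℕ) : ℝ≥0∞ :=
  expect (B.ftvaLaw π μ tb s₀ t) fun hx => ∑ i, mismatch (hx.2 i)
    * syncPotential (B.trans (B.armType i)) (π (B.armType i)) (hx.2 i)

/-- The expected number of arms whose real and virtual state-action pairs differ. -/
noncomputable def expectedMismatch (t : ℕ) : ℝ≥0∞ :=
  expect (B.ftvaLaw π μ tb s₀ t) fun hx => ∑ i, mismatch (hx.2 i)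

/-- The expected number of arms whose real and virtual actions differ. -/
noncomputable def expectedDisagreement (t : ℕ) : ℝ≥0∞ :=
  expect (B.ftvaLaw π μ tb s₀ t) fun hx => ∑ i, disagreement (hx.2 i)

/-- The drift inequality: replacing actual by followed actions at time `t + 1` costs `τ` per
disagreement, and the followed step releases one unit per mismatch at time `t`. -/
theorem totalPotential_succ_add_le {τ : ℝ≥0∞}
    (hτ : ∀ k x, syncPotential (B.trans k) (π k) x ≤ τ) (t : ℕ) :
    totalPotential B π μ tb s₀ (t + 1) + expectedMismatch B π μ tb s₀ t
      ≤ totalPotential B π μ tb s₀ t + τ * expectedDisagreement B π μ tb s₀ (t + 1) := by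
  have hstep : ∀ i, expect (B.ftvaLaw π μ tb s₀ (t + 1)) (fun hx => unsynced (followed (hx.2 i))
        * syncPotential (B.trans (B.armType i)) (π (B.armType i)) (followed (hx.2 i)))
      = expect (B.ftvaLaw π μ tb s₀ t) fun hx => killedStep (B.trans (B.armType i))
        (π (B.armType i)) (syncPotential (B.trans (B.armType i)) (π (B.armType i))) (hx.2 i) := by
    intro i
    have h := expect_map (B.ftvaLaw π μ tb s₀ (t + 1)) (fun hx => followed (hx.2 i))
      fun x => unsynced x * syncPotential (B.trans (B.armType i)) (π (B.armType i)) x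
    rw [← h, ftvaLaw_succ_map_followed, expect_bind]
    rfl
  calc totalPotential B π μ tb s₀ (t + 1) + expectedMismatch B π μ tb s₀ t
      ≤ (expect (B.ftvaLaw π μ tb s₀ (t + 1)) fun hx => (∑ i, unsynced (followed (hx.2 i))
          * syncPotential (B.trans (B.armType i)) (π (B.armType i)) (followed (hx.2 i)))
          + τ * ∑ i, disagreement (hx.2 i)) + expectedMismatch B π μ tb s₀ t := by
        gcongr
        refine expect_mono fun hx _ => ?_
        rw [Finset.mul_sum, ← Finset.sum_add_distrib]
        exact Finset.sum_le_sum fun i _ => mismatch_mul_le (hτ _) (hx.2 i)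
    _ = totalPotential B π μ tb s₀ t + τ * expectedDisagreement B π μ tb s₀ (t + 1) := by
        rw [expect_add, expect_const_mul, expect_sum]
        simp only [hstep]
        rw [← expect_sum, add_right_comm]
        congr 1
        rw [expectedMismatch, ← expect_add, totalPotential]
        congr 1
        funext hx
        rw [← Finset.sum_add_distrib]
        exact Finset.sum_congr rfl fun i _ => killedStep_syncPotential _ _ _

theorem sum_expectedMismatch_le {τ D : ℝ≥0∞}
    (hτ : ∀ k x, syncPotential (B.trans k) (π k) x ≤ τ)
    (hD : ∀ t, expectedDisagreement B π μ tb s₀ t ≤ D) (T : ℕ) :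
    ∑ t ∈ Finset.range T, expectedMismatch B π μ tb s₀ t ≤ N * τ + T * (τ * D) := by
  have h0 : totalPotential B π μ tb s₀ 0 ≤ N * τ := by
    rw [← expect_const (B.ftvaLaw π μ tb s₀ 0) (N * τ), totalPotential]
    refine expect_mono fun hx _ => ?_
    calc _ ≤ ∑ _i : Fin N, τ := by
          refine Finset.sum_le_sum fun i _ => (mul_le_of_le_one_left' ?_).trans (hτ _ _)
          rw [mismatch]
          split_ifs <;> simp
      _ = N * τ := by simp
  -- The final potential is kept in the induction so that the drift telescopes, and is dropped at
  -- the end.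
  have h : ∑ t ∈ Finset.range T, expectedMismatch B π μ tb s₀ t + totalPotential B π μ tb s₀ T
      ≤ N * τ + T * (τ * D) := by
    induction T with
    | zero => simpa using h0
    | succ T ih =>
      rw [Finset.sum_range_succ, add_assoc, add_comm (expectedMismatch _ _ _ _ _ _)]
      calc _ ≤ ∑ t ∈ Finset.range T, expectedMismatch B π μ tb s₀ t
            + (totalPotential B π μ tb s₀ T + τ * D) := by
            refine add_le_add le_rfl ((totalPotential_succ_add_le B π μ tb s₀ hτ T).trans ?_)
            gcongr
            exact hD _
        _ ≤ N * τ + T * (τ * D) + τ * D := by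
            rw [← add_assoc]
            gcongr
        _ = _ := by
            push_cast
            ring
  exact le_self_add.trans h

variable {B tb}

theorem isSelection_of_mem_support (htb : TieBreaking.Valid B tb) (t : ℕ)
    {hx : List (Fin N → ArmPair S) × (Fin N → ArmPair S)}
    (h : hx ∈ (B.ftvaLaw π μ tb s₀ t).support) :
    B.IsSelection (fun i => (hx.2 i).vaction) fun i => (hx.2 i).action := by
  have hact : ∀ {l s v}, hx ∈ (B.ftvaAct π tb l s v).support →
      B.IsSelection (fun i => (hx.2 i).vaction) fun i => (hx.2 i).action := by
    intro l s v h
    rw [ftvaAct, PMF.mem_support_bind_iff] at h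
    obtain ⟨va, -, h⟩ := h
    rw [PMF.mem_support_map_iff] at h
    obtain ⟨a, ha, rfl⟩ := h
    exact htb _ _ _ _ a ha
  cases t with
  | zero =>
    rw [ftvaLaw, PMF.mem_support_bind_iff] at h
    obtain ⟨_, -, h⟩ := h
    exact hact h
  | succ t =>
    rw [ftvaLaw, PMF.mem_support_bind_iff] at h
    obtain ⟨_, -, h⟩ := h
    rw [PMF.mem_support_bind_iff] at h
    obtain ⟨_, -, h⟩ := h
    exact hact h

omit [Fintype S] [DecidableEq S] in
/-- A selection changes as few actions as possible. -/
theorem IsSelection.card_ne {va a : Fin N → Bool} (h : B.IsSelection va a) :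
    ((Finset.univ.filter fun i => ¬ a i = va i).card : ℝ)
      = |(numActive va : ℝ) - B.budget| := by
  have hsum : ∀ b : Fin N → Bool, (numActive b : ℝ) = ∑ i, if b i = true then 1 else 0 := by
    intro b
    rw [Finset.sum_boole]
    rfl
  have hne : ((Finset.univ.filter fun i => ¬ a i = va i).card : ℝ)
      = ∑ i, if ¬ a i = va i then 1 else 0 := by
    rw [Finset.sum_boole]
  rw [hne, ← h.1]
  by_cases hle : B.budget ≤ numActive va
  · have hsub := h.2
    rw [if_pos hle] at hsub
    rw [abs_of_nonneg (by rw [h.1]; exact sub_nonneg.2 (Nat.cast_le.2 hle)), hsum, hsum,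
      ← Finset.sum_sub_distrib]
    refine Finset.sum_congr rfl fun i _ => ?_
    have := hsub i
    cases ha : a i <;> cases hva : va i <;> simp_all
  · have hsub := h.2
    rw [if_neg hle] at hsub
    rw [abs_of_nonpos (by rw [h.1]; exact sub_nonpos.2 (Nat.cast_le.2 (not_le.1 hle).le)), neg_sub,
      hsum, hsum, ← Finset.sum_sub_distrib]
    refine Finset.sum_congr rfl fun i _ => ?_
    have := hsub i
    cases ha : a i <;> cases hva : va i <;> simp_all

end VirtualAdvice

end RestlessBandit

namespace RestlessBandit

/-! ### The finite-horizon performance bound -/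

section Performance

variable {N K : ℕ} {S : Type*} [Fintype S] {B : RestlessBandit N K S}
  {y : Fin K → S → Bool → ℝ} {π : Fin K → S → PMF Bool} {μ : Fin K → PMF S}

theorem toReal_virtualPMF_apply (k : Fin K) (s : S) (a : Bool) :
    (virtualPMF π μ k (s, a)).toReal = (μ k s).toReal * (π k s a).toReal := by
  classical
  have h : ∀ s', mean ((π k s').map fun a' => (s', a')) (fun z => if z = (s, a) then 1 else 0)
      = if s' = s then (π k s a).toReal else 0 := by
    intro s'
    rw [mean_map]
    split_ifs with hs
    · simp only [hs, Prod.mk.injEq, true_and, mean_indicator_eq]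
    · simp only [hs, Prod.mk.injEq, false_and, if_false, mean_const]
  rw [← mean_indicator_eq, virtualPMF, mean_bind]
  simp only [h]
  simp [mean]

omit [Fintype S] in
/-- A weighted sum over types is an average over arms. -/
theorem sum_beta_mul (f : Fin K → ℝ) :
    ∑ k, B.beta k * f k = (1 / (N : ℝ)) * ∑ i, f (B.armType i) := by
  rw [← sum_type_sum_arm (B := B), Finset.mul_sum]
  refine Finset.sum_congr rfl fun k _ => ?_
  rw [Finset.sum_congr rfl fun i hi => by rw [(Finset.mem_filter.1 hi).2], Finset.sum_const,
    nsmul_eq_mul, beta]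
  ring

theorem meanReward_virtual
    (hfreq : ∀ k s a, (μ k s).toReal * (π k s a).toReal = y k s a) :
    B.meanReward (productPMF fun i => virtualPMF π μ (B.armType i)) = B.lpObjective y := by
  simp only [meanReward_eq_sum, productPMF_map_eval, lpObjective, mul_assoc, ← Finset.mul_sum]
  rw [sum_beta_mul]
  simp only [mean, Fintype.sum_prod_type, toReal_virtualPMF_apply, hfreq, mul_comm (y _ _ _)]

theorem sum_mean_virtualPMF_action (hN : N ≠ 0) (hy : B.LPFeasible y)
    (hfreq : ∀ k s a, (μ k s).toReal * (π k s a).toReal = y k s a) :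
    ∑ i, mean (virtualPMF π μ (B.armType i)) (fun z => if z.2 then 1 else 0) = B.budget := by
  have hN' : (N : ℝ) ≠ 0 := Nat.cast_ne_zero.2 hN
  have h := hy.budget_eq
  simp only [← Finset.mul_sum, alpha] at h
  rw [sum_beta_mul (B := B) fun k => ∑ s, y k s true] at h
  simp only [mean, Fintype.sum_prod_type, toReal_virtualPMF_apply, hfreq]
  field_simp at h
  simpa using h

variable [DecidableEq S] {tb : TieBreaking N S} (s₀ : Fin N → S)

/-- On the support, the number of disagreements is a function of the virtual arms alone: the
distance of their activation count from the budget. The budget is the mean of that count by the LP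
constraint, so the deviation bound applies. -/
theorem expectedDisagreement_le (hN : N ≠ 0) (hy : B.LPFeasible y)
    (hfreq : ∀ k s a, (μ k s).toReal * (π k s a).toReal = y k s a)
    (hμ : ∀ k, IsStationaryDistribution (B.trans k) (π k) (μ k))
    (htb : TieBreaking.Valid B tb) (t : ℕ) :
    expectedDisagreement B π μ tb s₀ t ≤ ENNReal.ofReal (√N / 2) := by
  have h1 : ∀ hx ∈ (B.ftvaLaw π μ tb s₀ t).support, ∑ i, disagreement (hx.2 i)
      = ENNReal.ofReal |((Finset.univ.filter fun i => (virtualPart hx.2 i).2 = true).card : ℝ)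
        - ∑ i, mean (virtualPMF π μ (B.armType i)) fun z => if z.2 then 1 else 0| := by
    intro hx h
    rw [sum_mean_virtualPMF_action hN hy hfreq]
    have hc := IsSelection.card_ne (isSelection_of_mem_support π μ s₀ htb t h)
    change _ = ENNReal.ofReal |((numActive fun i => (hx.2 i).vaction : ℕ) : ℝ) - B.budget|
    rw [← hc, ENNReal.ofReal_natCast, ← Finset.sum_boole]
    refine Finset.sum_congr rfl fun i _ => ?_
    simp only [disagreement, ite_not]
  have h2 := mean_abs_card_sub_le (fun i => virtualPMF π μ (B.armType i)) Prod.snd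
  rw [Fintype.card_fin] at h2
  rw [expectedDisagreement, expect_congr h1]
  have h3 := expect_map (B.ftvaLaw π μ tb s₀ t) (fun hx => virtualPart hx.2) fun w =>
    ENNReal.ofReal |((Finset.univ.filter fun i => (w i).2 = true).card : ℝ)
        - ∑ i, mean (virtualPMF π μ (B.armType i)) fun z => if z.2 then 1 else 0|
  rw [← h3, ftvaLaw_map_virtual B π μ tb s₀ hμ, expect_ofReal _ fun _ => abs_nonneg _]
  exact ENNReal.ofReal_le_ofReal h2

/-- Real and virtual arms are compared pointwise under the coupled law; rewards agree on matched
arms and differ by at most `2 * rMax` on the others. -/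
theorem lpObjective_sub_le_meanReward
    (hfreq : ∀ k s a, (μ k s).toReal * (π k s a).toReal = y k s a)
    (hμ : ∀ k, IsStationaryDistribution (B.trans k) (π k) (μ k)) (t : ℕ) :
    B.lpObjective y - 2 * B.rMax / N * (expectedMismatch B π μ tb s₀ t).toReal
      ≤ B.meanReward ((B.ftvaLaw π μ tb s₀ t).map fun hx => realPart hx.2) := by
  set q : PMF (Fin N → ArmPair S) := (B.ftvaLaw π μ tb s₀ t).map Prod.snd with hq
  have hreal : ((B.ftvaLaw π μ tb s₀ t).map fun hx => realPart hx.2) = q.map realPart := by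
    rw [hq, PMF.map_comp]
    rfl
  have hvirt : B.lpObjective y = B.meanReward (q.map virtualPart) := by
    rw [← meanReward_virtual hfreq, ← ftvaLaw_map_virtual B π μ tb s₀ hμ t, hq, PMF.map_comp]
    rfl
  have hmis : expectedMismatch B π μ tb s₀ t
      = ENNReal.ofReal (mean q fun x => ∑ i, (mismatch (x i)).toReal) := by
    rw [← expect_ofReal _ fun x => Finset.sum_nonneg fun i _ => ENNReal.toReal_nonneg, hq,
      expect_map, expectedMismatch]
    congr 1
    funext hx
    rw [ENNReal.ofReal_sum_of_nonneg fun i _ => ENNReal.toReal_nonneg]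
    refine Finset.sum_congr rfl fun i _ => (ENNReal.ofReal_toReal ?_).symm
    rw [mismatch]
    split_ifs <;> simp
  clear_value q
  rw [hmis, ENNReal.toReal_ofReal (mean_nonneg fun x => Finset.sum_nonneg fun i _ =>
    ENNReal.toReal_nonneg), hreal, hvirt, meanReward_eq_mean, meanReward_eq_mean, mean_map,
    mean_map, ← mean_const_mul, ← mean_sub]
  refine mean_mono fun x _ => ?_
  have hi : ∀ i, B.reward (B.armType i) (x i).vstate (x i).vaction
      - 2 * B.rMax * (mismatch (x i)).toReal
      ≤ B.reward (B.armType i) (x i).state (x i).action := by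
    intro i
    have h1 := abs_le.1 (B.abs_reward_le_rMax (B.armType i) (x i).vstate (x i).vaction)
    have h2 := abs_le.1 (B.abs_reward_le_rMax (B.armType i) (x i).state (x i).action)
    rw [mismatch]
    split_ifs with h
    · rw [h.1, h.2]
      simp
    · simp only [ENNReal.toReal_one]
      linarith [h1.2, h2.1]
  have hsum := Finset.sum_le_sum fun i (_ : i ∈ Finset.univ) => hi i
  rw [Finset.sum_sub_distrib, ← Finset.mul_sum] at hsum
  have hmul := mul_le_mul_of_nonneg_left hsum (by positivity : (0 : ℝ) ≤ 1 / N)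
  refine le_trans (le_of_eq ?_) hmul
  simp only [virtualPart]
  ring

/-- The finite-horizon performance bound. -/
theorem lpObjective_sub_le_averageReward (hN : N ≠ 0) (hy : B.LPFeasible y)
    (hfreq : ∀ k s a, (μ k s).toReal * (π k s a).toReal = y k s a)
    (hμ : ∀ k, IsStationaryDistribution (B.trans k) (π k) (μ k))
    (htb : TieBreaking.Valid B tb) {τ : ℝ} (hτ0 : 0 ≤ τ)
    (hτ : ∀ k x, syncPotential (B.trans k) (π k) x ≤ ENNReal.ofReal τ) {T : ℕ} (hT : T ≠ 0) :
    B.lpObjective y - B.rMax * τ / √N - 2 * B.rMax * τ * (1 / (T : ℝ))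
      ≤ B.ftvaAverageReward π μ tb s₀ T := by
  have hN' : (0 : ℝ) < N := Nat.cast_pos.2 (Nat.pos_of_ne_zero hN)
  have hT' : (0 : ℝ) < T := Nat.cast_pos.2 (Nat.pos_of_ne_zero hT)
  have hsum := sum_expectedMismatch_le B π μ tb s₀ hτ
    (expectedDisagreement_le s₀ hN hy hfreq hμ htb) T
  have hbound : (N : ℝ≥0∞) * ENNReal.ofReal τ
      + T * (ENNReal.ofReal τ * ENNReal.ofReal (√N / 2))
      = ENNReal.ofReal (N * τ + T * (τ * (√N / 2))) := by
    rw [ENNReal.ofReal_add (by positivity) (by positivity), ENNReal.ofReal_mul (by positivity),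
      ENNReal.ofReal_mul (by positivity), ENNReal.ofReal_mul hτ0, ENNReal.ofReal_natCast,
      ENNReal.ofReal_natCast]
  rw [hbound] at hsum
  have hfin : ∀ t ∈ Finset.range T, expectedMismatch B π μ tb s₀ t ≠ ∞ := fun t ht =>
    ne_top_of_le_ne_top ENNReal.ofReal_ne_top
      ((Finset.single_le_sum (fun _ _ => zero_le) ht).trans hsum)
  have hsum' : ∑ t ∈ Finset.range T, (expectedMismatch B π μ tb s₀ t).toReal
      ≤ N * τ + T * (τ * (√N / 2)) := by
    rw [← ENNReal.toReal_sum hfin]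
    exact ENNReal.toReal_le_of_le_ofReal (by positivity) hsum
  have hreward := Finset.sum_le_sum fun t (_ : t ∈ Finset.range T) =>
    lpObjective_sub_le_meanReward (tb := tb) s₀ hfreq hμ t
  rw [Finset.sum_sub_distrib, Finset.sum_const, Finset.card_range, nsmul_eq_mul,
    ← Finset.mul_sum] at hreward
  have hr := B.rMax_nonneg
  calc B.lpObjective y - B.rMax * τ / √N - 2 * B.rMax * τ * (1 / (T : ℝ))
      = 1 / (T : ℝ) * (T * B.lpObjective y
        - 2 * B.rMax / N * (N * τ + T * (τ * (√N / 2)))) := by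
        -- Writing `N` as `√N * √N` turns the identity into a rational one: the initial potential `N
        -- * τ` yields the `1 / T` term, the disagreements yield `1 / √N`.
        have hs : √(N : ℝ) ≠ 0 := (Real.sqrt_pos.2 hN').ne'
        have hsq : (N : ℝ) = √N * √N := (Real.mul_self_sqrt hN'.le).symm
        generalize √(N : ℝ) = w at hs hsq ⊢
        rw [hsq]
        field_simp
        ring
    _ ≤ 1 / (T : ℝ) * (T * B.lpObjective y
        - 2 * B.rMax / N * ∑ t ∈ Finset.range T, (expectedMismatch B π μ tb s₀ t).toReal) := by
        gcongr
    _ ≤ _ := mul_le_mul_of_nonneg_left hreward (by positivity)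

end Performance

/-! ### A mean ergodic theorem and existence of the limit -/

section Convergence

/-- The increments of a bounded sequence over a long time are small on average. -/
theorem tendsto_smul_sub_of_bounded {V : Type*} [NormedAddCommGroup V] [NormedSpace ℝ V]
    {b : ℕ → V} {C : ℝ} (hb : ∀ n, ‖b n‖ ≤ C) :
    Tendsto (fun T : ℕ => (1 / (T : ℝ)) • (b T - b 0)) atTop (𝓝 0) := by
  refine squeeze_zero_norm (a := fun T : ℕ => (1 / (T : ℝ)) * (2 * C)) (fun T => ?_) ?_
  · rw [norm_smul, Real.norm_of_nonneg (by positivity)]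
    gcongr
    linarith [norm_sub_le (b T) (b 0), hb T, hb 0]
  · simpa using (tendsto_one_div_atTop_nhds_zero_nat (𝕜 := ℝ)).mul_const (2 * C)

/-- The time averages of the powers of a contraction of a finite-dimensional space converge. -/
theorem exists_tendsto_average_pow {V : Type*} [NormedAddCommGroup V] [NormedSpace ℝ V]
    [FiniteDimensional ℝ V] (Q : V →ₗ[ℝ] V) (hQ : ∀ v, ‖Q v‖ ≤ ‖v‖) (v : V) :
    ∃ w, Tendsto (fun T : ℕ => (1 / (T : ℝ)) • ∑ t ∈ Finset.range T, (Q ^ t) v) atTop (𝓝 w) := by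
  have hpow : ∀ (n : ℕ) (v : V), ‖(Q ^ n) v‖ ≤ ‖v‖ := by
    intro n v
    induction n with
    | zero => simp
    | succ n ih =>
      rw [pow_succ', Module.End.mul_apply]
      exact (hQ _).trans ih
  have hrange : ∀ b : V, Tendsto (fun T : ℕ => (1 / (T : ℝ)) • ∑ t ∈ Finset.range T,
      (Q ^ t) ((Q - 1) b)) atTop (𝓝 0) := by
    intro b
    have e : ∀ T, ∑ t ∈ Finset.range T, (Q ^ t) ((Q - 1) b) = (Q ^ T) b - (Q ^ 0) b := by
      intro T
      rw [← Finset.sum_range_sub fun t => (Q ^ t) b]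
      refine Finset.sum_congr rfl fun t _ => ?_
      rw [LinearMap.sub_apply, map_sub, Module.End.one_apply, pow_succ, Module.End.mul_apply]
    simp only [e]
    exact tendsto_smul_sub_of_bounded fun n => hpow n b
  have hker : ∀ a : V, Q a = a → Tendsto (fun T : ℕ => (1 / (T : ℝ)) • ∑ t ∈ Finset.range T,
      (Q ^ t) a) atTop (𝓝 a) := by
    intro a ha
    have e : ∀ t : ℕ, (Q ^ t) a = a := by
      intro t
      induction t with
      | zero => simp
      | succ t ih => rw [pow_succ, Module.End.mul_apply, ha, ih]
    refine tendsto_const_nhds.congr' ?_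
    filter_upwards [eventually_gt_atTop 0] with T hT
    have hT' : (T : ℝ) ≠ 0 := by positivity
    simp only [e, Finset.sum_const, Finset.card_range, ← Nat.cast_smul_eq_nsmul ℝ, smul_smul]
    rw [one_div_mul_cancel hT', one_smul]
  -- Averages of a fixed vector tend to itself, those of a vector in the range of `Q - 1` tend to
  -- zero. By rank-nullity the two subspaces then span everything.
  have hdisj : Disjoint (LinearMap.ker (Q - 1)) (LinearMap.range (Q - 1)) := by
    rw [Submodule.disjoint_def]
    rintro a ha ⟨b, rfl⟩
    rw [LinearMap.mem_ker, LinearMap.sub_apply, sub_eq_zero, Module.End.one_apply] at ha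
    exact tendsto_nhds_unique (hker _ ha) (hrange b)
  have htop : LinearMap.ker (Q - 1) ⊔ LinearMap.range (Q - 1) = ⊤ := by
    refine Submodule.eq_top_of_disjoint _ _ ?_ hdisj
    rw [add_comm, LinearMap.finrank_range_add_finrank_ker]
  obtain ⟨a, ha, c, ⟨b, rfl⟩, rfl⟩ := Submodule.mem_sup.1 (htop ▸ Submodule.mem_top (x := v))
  rw [LinearMap.mem_ker, LinearMap.sub_apply, sub_eq_zero, Module.End.one_apply] at ha
  refine ⟨a + 0, ?_⟩
  simp only [map_add, Finset.sum_add_distrib, smul_add]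
  exact (hker a ha).add (hrange b)

variable {X : Type*} [Fintype X]

/-- The transition operator of a finite Markov chain. -/
noncomputable def transitionOperator (κ : X → PMF X) : (X → ℝ) →ₗ[ℝ] (X → ℝ) where
  toFun f x := mean (κ x) f
  map_add' f g := funext fun x => mean_add (κ x) f g
  map_smul' c f := funext fun x => mean_const_mul (κ x) c f

theorem norm_transitionOperator_le (κ : X → PMF X) (f : X → ℝ) :
    ‖transitionOperator κ f‖ ≤ ‖f‖ := by
  refine (pi_norm_le_iff_of_nonneg (norm_nonneg f)).2 fun x => ?_
  have hf : ∀ z, |f z| ≤ ‖f‖ := fun z => norm_le_pi_norm f z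
  rw [Real.norm_eq_abs, abs_le]
  refine ⟨?_, ?_⟩
  · rw [← mean_const (κ x) (-‖f‖)]
    exact mean_mono fun z _ => (abs_le.1 (hf z)).1
  · rw [← mean_const (κ x) ‖f‖]
    exact mean_mono fun z _ => (abs_le.1 (hf z)).2

theorem mean_chain_eq (κ : X → PMF X) {q : ℕ → PMF X} (hq : ∀ t, q (t + 1) = (q t).bind κ)
    (t : ℕ) (f : X → ℝ) : mean (q t) f = mean (q 0) ((transitionOperator κ ^ t) f) := by
  induction t generalizing f with
  | zero => simp
  | succ t ih =>
    rw [hq, mean_bind, pow_succ, Module.End.mul_apply, ← ih]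
    rfl

/-- The time averages of the expectations of a function of a finite Markov chain converge. -/
theorem exists_tendsto_average_mean (κ : X → PMF X) {q : ℕ → PMF X}
    (hq : ∀ t, q (t + 1) = (q t).bind κ) (f : X → ℝ) :
    ∃ V, Tendsto (fun T : ℕ => (1 / (T : ℝ)) * ∑ t ∈ Finset.range T, mean (q t) f) atTop
      (𝓝 V) := by
  obtain ⟨w, hw⟩ := exists_tendsto_average_pow (transitionOperator κ)
    (norm_transitionOperator_le κ) f
  refine ⟨mean (q 0) w, ?_⟩
  have hlim : Tendsto (fun T : ℕ => mean (q 0) ((1 / (T : ℝ)) • ∑ t ∈ Finset.range T,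
      (transitionOperator κ ^ t) f)) atTop (𝓝 (mean (q 0) w)) :=
    tendsto_finsetSum _ fun x _ => (hw.apply_nhds x).const_mul _
  refine hlim.congr fun T => ?_
  rw [Finset.sum_congr rfl fun t _ => mean_chain_eq κ hq t f, ← mean_sum, ← mean_const_mul]
  congr 1
  funext x
  simp [Finset.sum_apply]

variable {N K : ℕ} {S : Type*} [Fintype S] [DecidableEq S]

/-- When the selection ignores the past, the recorded history can be projected away, and what
remains is a time-homogeneous chain on the finite set of vectors of pairs. -/
theorem exists_tendsto_ftvaAverageReward (B : RestlessBandit N K S) (π : Fin K → S → PMF Bool)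
    (μ : Fin K → PMF S) {tb : TieBreaking N S} (htb : TieBreaking.Stationary tb)
    (s₀ : Fin N → S) : ∃ V, Tendsto (B.ftvaAverageReward π μ tb s₀) atTop (𝓝 V) := by
  have hact : ∀ h s v, (B.ftvaAct π tb h s v).map Prod.snd
      = (B.ftvaAct π tb [] s v).map Prod.snd := by
    intro h s v
    simp only [ftvaAct, PMF.map_bind, PMF.map_comp, Function.comp_def, htb h []]
  obtain ⟨V, hV⟩ := exists_tendsto_average_mean
    (fun x : Fin N → ArmPair S =>
      (productPMF fun i => coupledStep (B.trans (B.armType i)) (x i)).bind fun z =>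
        (B.ftvaAct π tb [] (fun i => (z i).1) fun i => (z i).2).map Prod.snd)
    (q := fun t => (B.ftvaLaw π μ tb s₀ t).map Prod.snd)
    (fun t => by
      rw [ftvaLaw, PMF.map_bind, PMF.bind_map]
      simp only [PMF.map_bind, Function.comp_def, hact (_ :: _)])
    (fun x => (1 / (N : ℝ)) * ∑ i, B.reward (B.armType i) (realPart x i).1 (realPart x i).2)
  refine ⟨V, hV.congr fun T => ?_⟩
  rw [ftvaAverageReward, averageReward]
  congr 1
  refine Finset.sum_congr rfl fun t _ => ?_
  rw [← mean_map _ realPart fun w => (1 / (N : ℝ)) * ∑ i, B.reward (B.armType i) (w i).1 (w i).2,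
    PMF.map_comp]
  rfl

end Convergence

/-! ### The maximal expected synchronization time bounds the potential -/

section SynchronizationTime

variable {N K : ℕ} {S : Type*} [Fintype S] [DecidableEq S]

theorem syncPotential_le_tauMax (B : RestlessBandit N K S) {π : Fin K → S → PMF Bool}
    (hSA : ∀ k, SyncAssumption (B.trans k) (π k)) (k : Fin K) (x : ArmPair S) :
    syncPotential (B.trans k) (π k) x ≤ ENNReal.ofReal (B.tauMax π) := by
  -- Finiteness matters because `toReal` sends `∞` to `0`; it follows from SA since there are
  -- finitely many types and pairs.
  have hfin : ⨆ (k : Fin K) (x : ArmPair S), expectedSyncTime (B.trans k) (π k) x ≠ ∞ := by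
    refine ne_top_of_le_ne_top (b := ∑ k, ∑ x, expectedSyncTime (B.trans k) (π k) x)
      (ENNReal.sum_ne_top.2 fun k _ => ENNReal.sum_ne_top.2 fun x _ => (hSA k x).ne)
      (iSup₂_le fun k x => ?_)
    exact (Finset.single_le_sum (f := fun x => expectedSyncTime (B.trans k) (π k) x)
      (fun _ _ => zero_le) (Finset.mem_univ x)).trans
      (Finset.single_le_sum (f := fun k => ∑ x, expectedSyncTime (B.trans k) (π k) x)
      (fun _ _ => zero_le) (Finset.mem_univ k))
  rw [tauMax, ENNReal.ofReal_toReal hfin]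
  exact (syncPotential_le_expectedSyncTime _ _ _).trans
    (le_iSup₂ (f := fun k x => expectedSyncTime (B.trans k) (π k) x) k x)

end SynchronizationTime

end RestlessBandit

/-! ### The main theorem -/

theorem mainTheorem4 {N K : ℕ} {S : Type*} [Fintype S] [DecidableEq S]
    (B : RestlessBandit N K S)
    (hbudget_pos : 0 < B.budget) (hbudget_lt : B.budget < N)
    (hunichain : ∀ k, RestlessBandit.IsUnichain (B.trans k))
    (y : Fin K → S → Bool → ℝ) (hy : B.LPOptimal y)
    (π : Fin K → S → PMF Bool) (hπ : RestlessBandit.InducedBy π y)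
    (hSA : ∀ k, RestlessBandit.SyncAssumption (B.trans k) (π k))
    (μ : Fin K → PMF S)
    (hμ : ∀ k, RestlessBandit.IsStationaryDistribution (B.trans k) (π k) (μ k))
    (tb : RestlessBandit.TieBreaking N S) (htb : RestlessBandit.TieBreaking.Valid B tb)
    (s₀ : Fin N → S) :
    (∀ s₁ : Fin N → S,
      B.optimalValue s₁ - liminf (B.ftvaAverageReward π μ tb s₀) atTop
        ≤ B.rMax * B.tauMax π / √(N : ℝ)) ∧
    (RestlessBandit.TieBreaking.Stationary tb →
      ∃ V : ℝ, Tendsto (B.ftvaAverageReward π μ tb s₀) atTop (𝓝 V) ∧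
        ∀ s₁ : Fin N → S,
          B.optimalValue s₁ - V ≤ B.rMax * B.tauMax π / √(N : ℝ)) := by
  have hN : N ≠ 0 := by omega
  have hfreq : ∀ k s a, (μ k s).toReal * (π k s a).toReal = y k s a := fun k s a =>
    RestlessBandit.stationary_mul_policy B hy.1 hπ (hunichain k) (hμ k) s a
  -- The supremum over policies must not be empty. A valid tie-breaking rule fed with dummy virtual
  -- data already respects the budget.
  have hne : ∃ ρ : RestlessBandit.Policy N S, RestlessBandit.Policy.Admissible B ρ :=
    ⟨fun _ s => tb [] s s fun _ => true, fun _ s a ha => (htb [] s s _ a ha).1⟩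
  have hτ0 : 0 ≤ B.tauMax π := ENNReal.toReal_nonneg
  set bound := B.rMax * B.tauMax π / √(N : ℝ) with hbound
  have hlow : Tendsto (fun T : ℕ => B.lpObjective y - bound
      - 2 * B.rMax * B.tauMax π * (1 / (T : ℝ))) atTop (𝓝 (B.lpObjective y - bound)) := by
    simpa using ((tendsto_one_div_atTop_nhds_zero_nat (𝕜 := ℝ)).const_mul
      (2 * B.rMax * B.tauMax π)).const_sub (B.lpObjective y - bound)
  have hle : ∀ᶠ T : ℕ in atTop, B.lpObjective y - bound
      - 2 * B.rMax * B.tauMax π * (1 / (T : ℝ)) ≤ B.ftvaAverageReward π μ tb s₀ T := by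
    filter_upwards [eventually_ne_atTop 0] with T hT
    exact RestlessBandit.lpObjective_sub_le_averageReward s₀ hN hy.1 hfreq hμ htb hτ0
      (B.syncPotential_le_tauMax hSA) hT
  have hliminf : B.lpObjective y - bound ≤ liminf (B.ftvaAverageReward π μ tb s₀) atTop := by
    rw [← hlow.liminf_eq]
    exact liminf_le_liminf hle hlow.isBoundedUnder_ge
      (B.isBoundedUnder_le_averageReward _).isCoboundedUnder_ge
  have hmain : ∀ s₁ : Fin N → S,
      B.optimalValue s₁ - liminf (B.ftvaAverageReward π μ tb s₀) atTop ≤ bound := fun s₁ => by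
    linarith [RestlessBandit.optimalValue_le_lpObjective hne hy s₁]
  refine ⟨hmain, fun hst => ?_⟩
  obtain ⟨V, hV⟩ := RestlessBandit.exists_tendsto_ftvaAverageReward B π μ hst s₀
  exact ⟨V, hV, hV.liminf_eq ▸ hmain⟩
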